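/- Let $A$ be a (not necessarily unital or separable) C*-algebra. For $a,b\in A$ write $a\sim_{\mathrm{Tr}}b$ if $a-b\in\overline{[A,A]}$, the closed linear span of the commutators $[c,d]=cd-dc$ with $c,d\in A$; that is, $\mathrm{Tr}(a-b)=0$, where $\mathrm{Tr}\colon A\to A/\overline{[A,A]}$ is the quotient map. The nuclear dimension of $A$ is at most $m$ if for every finite set $S\subseteq A$ and every $\delta>0$ there are a finite-dimensional C*-algebra $F=F^{(0)}\oplus\cdots\oplus F^{(m)}$, a completely positive contractive map $\psi\colon A\to F$ and a completely positive map $\varphi\colon F\to A$ such that $\|\varphi(\psi(a))-a\|<\delta$ for all $a\in S$ and each restriction $\varphi|_{F^{(i)}}$ is contractive and of order zero (that is, for positive $a,b\in F^{(i)}$ with $ab=0$ one has $\varphi(a)\varphi(b)=0$). **Theorem.** Let $A$ be a C*-algebra of nuclear dimension at most $1$, and let $h\in A$ be self-adjoint with $h\sim_{\mathrm{Tr}}0$. Then for each $\varepsilon>0$ there exist self-adjoint $h_1,h_2,h_3,h_4\in A$ such that (i) $\|h_1+h_2+h_3+h_4-h\|<\varepsilon$; (ii) $\|[h_1,h_2]\|<\varepsilon$,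 $\|[h_3,h_4]\|<\varepsilon$ and $\|[h_1+h_2,h_3+h_4]\|<\varepsilon$; (iii) for each $i=1,2,3,4$ there is $x_i\in A$ with $h_i=[x_i^*,x_i]$, $x_i^2=0$ and $\|x_i\|^2\le\|h\|$. -/

import Mathlib

open scoped CStarAlgebra

/-- The closed linear span `closure [A, A]` of the additive commutators of a C⋆-algebra `A`. -/
def closedCommutatorSpan (A : Type*) [NonUnitalCStarAlgebra A] : Submodule ℂ A :=
  (Submodule.span ℂ {c : A | ∃ a b : A, c = a * b - b * a}).topologicalClosure

/-- The universal trace `Tr : A → A / closure [A, A]`, i.e. the quotient map. -/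
def universalTrace (A : Type*) [NonUnitalCStarAlgebra A] :
    A →ₗ[ℂ] A ⧸ closedCommutatorSpan A :=
  (closedCommutatorSpan A).mkQ

/-- The relation `a ∼_Tr b`. -/
def TrEquiv {A : Type*} [NonUnitalCStarAlgebra A] (a b : A) : Prop :=
  universalTrace A (a - b) = 0

/-- A completely positive map is contractive if it does not increase norms. -/
def IsContractiveCP {A B : Type*}
    [NonUnitalCStarAlgebra A] [PartialOrder A] [StarOrderedRing A]
    [NonUnitalCStarAlgebra B] [PartialOrder B] [StarOrderedRing B] (φ : A →CP B) : Prop :=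
  ∀ a : A, ‖φ a‖ ≤ ‖a‖

/-- A completely positive map has order zero if it preserves orthogonality of
positive elements. -/
def IsOrderZero {A B : Type*}
    [NonUnitalCStarAlgebra A] [PartialOrder A] [StarOrderedRing A]
    [NonUnitalCStarAlgebra B] [PartialOrder B] [StarOrderedRing B] (φ : A →CP B) : Prop :=
  ∀ a b : A, 0 ≤ a → 0 ≤ b → a * b = 0 → φ a * φ b = 0

/-- The C⋆-algebra `A` has nuclear dimension at most `m` (Winter and Zacharias):
for every finite set `S ⊆ A` and `ε > 0` there are a finite-dimensional C⋆-algebra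
`F = F 0 ⊕ ⋯ ⊕ F m`, a completely positive contractive map `A → F`
and a completely positive map `F → A` whose restriction to each summand is contractive
of order zero, such that the composition `A → F → A` moves each element of `S` by less than `ε`.
The map `A → F` is given by its components `ψ i`, and the map `F → A` by its restrictions `φ i`;
as `F` carries the maximum norm, `A → F` is completely positive contractive
exactly when every `ψ i` is.

Finite-dimensional C⋆-algebras are unital, and each is isomorphic to a finite direct sum of matrix
algebras, so that those whose carrier lies in `Type` exhaust all of them up to isomorphism. -/
def NuclearDimensionAtMost (A : Type*)
    [NonUnitalCStarAlgebra A] [PartialOrder A] [StarOrderedRing A] (m : ℕ) : Prop :=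
  ∀ (S : Finset A) (ε : ℝ), 0 < ε →
    ∃ (F : Fin (m + 1) → Type)
      (_ : ∀ i, CStarAlgebra (F i)) (_ : ∀ i, PartialOrder (F i))
      (_ : ∀ i, StarOrderedRing (F i))
      (ψ : ∀ i, A →CP F i) (φ : ∀ i, F i →CP A),
      (∀ i, FiniteDimensional ℂ (F i)) ∧
      (∀ i, IsContractiveCP (ψ i)) ∧
      (∀ i, IsContractiveCP (φ i)) ∧
      (∀ i, IsOrderZero (φ i)) ∧
      ∀ a ∈ S, ‖(∑ i, φ i (ψ i a)) - a‖ < ε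

/-!
The proof treats each of the two order zero summands `φ : F → A` of an approximation
`A → F 0 ⊕ F 1 → A` separately, and produces two of the four self-commutators from each.

**One summand.** Let `F` be finite-dimensional and `k ∈ F` self-adjoint with eigenvalues `λ_p` on
pairwise orthogonal minimal projections `p`. If the eigenvalues sum to zero on each simple block of
`F`, they can be ordered blockwise so that all partial sums `s_j` are bounded by `‖k‖`, and then
`k = ∑ s_j (p_j - p_{j+1})`. The terms with `j` odd and those with `j` even form self-commutators
of square-zero elements built from partial isometries between `p_j` and `p_{j+1}`; these commute,
being diagonal (`exists_chain`). An order zero map satisfies `φ(a) φ(b) = φ(1) φ(a b)`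
(`IsOrderZero.map_mul_map`), so multiplying `φ(x)` by an approximate inverse square root of `φ(1)`
carries square-zero elements and their commuting self-commutators over to `A`
(`IsOrderZero.exists_lift`). If the normalized block traces of `k` are merely small on the blocks
where `φ` is not small, a small perturbation of `φ k` is still obtained
(`IsOrderZero.exists_commutators`).

**The maps `T i = φ i ∘ ψ i`.** As `T 0 + T 1` converges to the identity, each `T i` is asymptotically
a completely positive map dominated by the identity, hence asymptotically a bimodule map:
`T i (a b) ≈ a T i (b) ≈ T i (a) b`. The Cauchy–Schwarz inequality for the form
`b* T(a* a') b'` makes this quantitative (`DecomposableApproximation.eventually_T_mul_left`). In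
particular `T 0 h` almost commutes with `h`, hence with `T 1 h ≈ h - T 0 h`.

**Traces.** The bimodule property gives `T(a) T(b) ≈ T(e²) T(a b)` for approximate units `e`, that is,
`φ(1) φ(ψ(a) ψ(b) - d ψ(a b)) ≈ 0` with `d = ψ(e²)`. On a block on which `φ` is bounded below this
forces `ψ(a) ψ(b) ≈ d ψ(a b)`, and since `(1 - d)ⁿ` nearly annihilates `ψ(e² y) ≈ ψ(y)`, the
normalized block trace of `ψ [a, b]` is small (`norm_blockTrace_commutator_le`). The elements `y`
whose images `ψ y` have asymptotically vanishing block traces form a closed subspace, so it contains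
every element of the closed commutator span, in particular `h`
(`DecomposableApproximation.closedCommutatorSpan_le`).
-/

/-! ### Completely positive maps as module-valued inner products -/

section CompletelyPositive

variable {A B : Type*} [NonUnitalCStarAlgebra A] [PartialOrder A] [StarOrderedRing A]
  [NonUnitalCStarAlgebra B] [PartialOrder B] [StarOrderedRing B]

lemma CStarMatrix.diag_nonneg {n : ℕ} {M : CStarMatrix (Fin n) (Fin n) B} (hM : 0 ≤ M)
    (i : Fin n) : 0 ≤ M i i := by
  rw [StarOrderedRing.nonneg_iff] at hM
  induction hM using AddSubmonoid.closure_induction with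
  | mem x hx =>
    obtain ⟨N, rfl⟩ := hx
    simp only [CStarMatrix.mul_apply, CStarMatrix.star_apply]
    exact Finset.sum_nonneg fun k _ => star_mul_self_nonneg _
  | zero => exact le_rfl
  | add x y _ _ hx hy => exact add_nonneg hx hy

/-- For a completely positive `T : A → B`, the `B`-valued form
`⟪a ⊗ b, a' ⊗ b'⟫ = b* T(a* a') b'` on `A ⊗ B` is positive. -/
lemma CompletelyPositiveMap.sum_star_mul_nonneg (T : A →CP B) {n : ℕ} (a : Fin n → A)
    (b : Fin n → B) : 0 ≤ ∑ i, ∑ j, star (b i) * T (star (a i) * a j) * b j := by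
  rcases n with - | n
  · simp
  let M : CStarMatrix (Fin (n + 1)) (Fin (n + 1)) A :=
    CStarMatrix.ofMatrix fun i j => if i = 0 then a j else 0
  let N : CStarMatrix (Fin (n + 1)) (Fin (n + 1)) B :=
    CStarMatrix.ofMatrix fun i j => if j = 0 then b i else 0
  have hM : ∀ i j, M i j = if i = 0 then a j else 0 := fun _ _ => rfl
  have hN : ∀ i j, N i j = if j = 0 then b i else 0 := fun _ _ => rfl
  have h1 := T.map_cstarMatrix_nonneg _ (star_mul_self_nonneg M)
  have h2 := CStarMatrix.diag_nonneg (star_left_conjugate_nonneg h1 N) 0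
  have h3 : ∀ i j, (star M * M) i j = star (a i) * a j := by
    intro i j
    rw [CStarMatrix.mul_apply, Finset.sum_eq_single 0]
    · simp [hM, CStarMatrix.star_apply]
    · intro k _ hk; simp [hM, CStarMatrix.star_apply, hk]
    · simp
  convert h2 using 1
  simp only [CStarMatrix.mul_apply, CStarMatrix.star_apply, CStarMatrix.map_apply, h3,
    Finset.sum_mul]
  rw [Finset.sum_comm]
  simp [hN]

lemma CompletelyPositiveMap.two_nonneg (T : A →CP B) (a₁ a₂ : A) (b₁ b₂ : B) :
    0 ≤ star b₁ * T (star a₁ * a₁) * b₁ + star b₁ * T (star a₁ * a₂) * b₂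
      + star b₂ * T (star a₂ * a₁) * b₁ + star b₂ * T (star a₂ * a₂) * b₂ := by
  have := T.sum_star_mul_nonneg ![a₁, a₂] ![b₁, b₂]
  simpa [Fin.sum_univ_succ, ← add_assoc] using this

lemma CompletelyPositiveMap.three_nonneg (T : A →CP B) (a₁ a₂ a₃ : A) (b₁ b₂ b₃ : B) :
    0 ≤ star b₁ * T (star a₁ * a₁) * b₁ + star b₁ * T (star a₁ * a₂) * b₂
      + star b₁ * T (star a₁ * a₃) * b₃
      + (star b₂ * T (star a₂ * a₁) * b₁ + star b₂ * T (star a₂ * a₂) * b₂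
      + star b₂ * T (star a₂ * a₃) * b₃)
      + (star b₃ * T (star a₃ * a₁) * b₁ + star b₃ * T (star a₃ * a₂) * b₂
      + star b₃ * T (star a₃ * a₃) * b₃) := by
  have := T.sum_star_mul_nonneg ![a₁, a₂, a₃] ![b₁, b₂, b₃]
  simpa [Fin.sum_univ_succ, ← add_assoc] using this

/-- The Cauchy–Schwarz inequality for a positive `2 × 2` matrix with entries `P`, `Y`, `Y*`, `Q`. -/
lemma CStarAlgebra.norm_sq_le_of_form_nonneg {P Q Y : B} (hQ : IsSelfAdjoint Q)
    (h : ∀ b b' : B, 0 ≤ star b * P * b + star b * Y * b' + star b' * star Y * b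
      + star b' * Q * b') :
    ‖Y‖ ^ 2 ≤ ‖P‖ * ‖Q‖ := by
  -- Test the form on `(Y, -s Y* Y)`.
  have key : ∀ s : ℝ, 0 ≤ s → ∀ κ : ℝ, ‖Q‖ ≤ κ → s * κ ≤ 1 → s * ‖Y‖ ^ 2 ≤ ‖P‖ := by
    intro s hs κ hκ hsκ
    have hκ0 : 0 ≤ κ := (norm_nonneg _).trans hκ
    set Z := star Y * Y with hZ
    have hZs : star Z = Z := by simp [hZ]
    have h1 := h Y (-(s : ℂ) • Z)
    have h2 : star Z * Q * Z ≤ κ • (star Z * Z) :=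
      (CStarAlgebra.star_left_conjugate_le_norm_smul (a := Z) (b := Q)).trans
        (smul_le_smul_of_nonneg_right hκ (star_mul_self_nonneg _))
    have h3 : 0 ≤ star Y * P * Y - (s : ℝ) • (Z * Z) := by
      have e1 : star Y * P * Y + star Y * Y * (-(s : ℂ) • Z) +
          star (-(s : ℂ) • Z) * star Y * Y + star (-(s : ℂ) • Z) * Q * (-(s : ℂ) • Z)
          = star Y * P * Y - (2 * s) • (Z * Z) + (s * s) • (star Z * Q * Z) := by
        simp only [star_smul, star_neg, Complex.star_def, Complex.conj_ofReal, ← hZ,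
          smul_mul_assoc, mul_smul_comm, mul_assoc, hZs, smul_smul]
        simp only [← Complex.coe_smul (E := B)]
        push_cast
        module
      rw [e1] at h1
      have h4 : (s * s) • (star Z * Q * Z) ≤ s • (Z * Z) := by
        calc (s * s) • (star Z * Q * Z) ≤ (s * s) • (κ • (star Z * Z)) :=
              smul_le_smul_of_nonneg_left h2 (by positivity)
          _ = (s * (s * κ)) • (star Z * Z) := by rw [smul_smul]; ring_nf
          _ ≤ s • (star Z * Z) := by
              apply smul_le_smul_of_nonneg_right _ (star_mul_self_nonneg _)
              nlinarith
          _ = s • (Z * Z) := by rw [hZs]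
      refine h1.trans ?_
      calc star Y * P * Y - (2 * s) • (Z * Z) + (s * s) • (star Z * Q * Z)
          ≤ star Y * P * Y - (2 * s) • (Z * Z) + s • (Z * Z) := by gcongr
        _ = star Y * P * Y - s • (Z * Z) := by module
    have h5 : ‖s • (Z * Z)‖ ≤ ‖star Y * P * Y‖ := by
      apply CStarAlgebra.norm_le_norm_of_nonneg_of_le
      · apply smul_nonneg hs
        have := star_mul_self_nonneg Z
        rwa [hZs] at this
      · exact sub_nonneg.mp h3
    have h6 : ‖Z * Z‖ = ‖Y‖ ^ 4 := by
      have := CStarRing.norm_star_mul_self (x := Z)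
      rw [hZs] at this
      rw [this, hZ, CStarRing.norm_star_mul_self]; ring
    rw [norm_smul, h6, Real.norm_of_nonneg hs] at h5
    have h7 : ‖star Y * P * Y‖ ≤ ‖Y‖ ^ 2 * ‖P‖ := by
      calc _ ≤ ‖star Y‖ * ‖P‖ * ‖Y‖ := (norm_mul_le _ _).trans (by gcongr; exact norm_mul_le _ _)
        _ = _ := by rw [norm_star]; ring
    rcases (norm_nonneg Y).eq_or_lt with h0 | h0
    · rw [← h0]; simp
    · have : ‖Y‖ ^ 2 * (s * ‖Y‖ ^ 2) ≤ ‖Y‖ ^ 2 * ‖P‖ := by nlinarith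
      exact le_of_mul_le_mul_left this (by positivity)
  rcases (norm_nonneg Q).eq_or_lt with h0 | h0
  · rw [← h0, mul_zero]
    by_contra hcon
    push Not at hcon
    have := key ((‖P‖ + 1) / ‖Y‖ ^ 2) (by positivity) 0 h0.symm.le (by simp)
    rw [div_mul_cancel₀ _ hcon.ne'] at this
    linarith
  · have := key (1 / ‖Q‖) (by positivity) ‖Q‖ le_rfl (by rw [div_mul_cancel₀ _ h0.ne'])
    rwa [one_div, inv_mul_le_iff₀ h0, mul_comm] at this

end CompletelyPositive

/-! ### Minimal projections of a finite-dimensional C⋆-algebra -/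

section FiniteDimensional

variable {F : Type*} [CStarAlgebra F]

/-- A nonzero self-adjoint idempotent `p` is a minimal projection if its corner `p F p` consists of
scalar multiples of `p`. -/
structure IsMinimalProjection (p : F) : Prop where
  isStarProjection : IsStarProjection p
  ne_zero : p ≠ 0
  corner : ∀ x : F, ∃ t : ℂ, p * x * p = t • p

lemma IsMinimalProjection.norm_eq_one {p : F} (hp : IsMinimalProjection p) : ‖p‖ = 1 := by
  have h1 := CStarRing.norm_star_mul_self (x := p)
  rw [hp.isStarProjection.isSelfAdjoint.star_eq, hp.isStarProjection.isIdempotentElem.eq] at h1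
  exact mul_left_cancel₀ (norm_ne_zero_iff.mpr hp.ne_zero) (by rw [← h1, mul_one])

lemma finite_spectrum_real [FiniteDimensional ℂ F] (a : F) : (spectrum ℝ a).Finite := by
  have h : (spectrum ℂ a).Finite := by
    refine (minpoly ℂ a).rootSet_finite ℂ |>.subset fun z hz => ?_
    have h0 : minpoly ℂ a ≠ 0 := minpoly.ne_zero (Algebra.IsIntegral.isIntegral a)
    have h1 := spectrum.subset_polynomial_aeval a (minpoly ℂ a) ⟨z, hz, rfl⟩
    rw [minpoly.aeval] at h1
    have : Nontrivial F := by
      by_contra hn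
      rw [not_nontrivial_iff_subsingleton] at hn
      simp [spectrum.of_subsingleton] at hz
    rw [spectrum.zero_eq, Set.mem_singleton_iff] at h1
    simpa [Polynomial.mem_rootSet, h0] using h1
  rw [← spectrum.preimage_algebraMap ℂ]
  exact h.preimage (algebraMap ℝ ℂ).injective.injOn

/-- The spectral decomposition of a self-adjoint element, with the spectral projections in the
bicommutant of the element. -/
lemma exists_spectral_projections [FiniteDimensional ℂ F] {a : F} (ha : IsSelfAdjoint a) :
    ∃ (s : Finset ℝ) (q : ℝ → F), (∀ μ, IsStarProjection (q μ)) ∧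
      (∀ μ ν, μ ≠ ν → q μ * q ν = 0) ∧ ∑ μ ∈ s, q μ = 1 ∧ (∀ μ, a * q μ = μ • q μ) ∧
      ∀ x, Commute a x → ∀ μ, Commute (q μ) x := by
  have hfin := finite_spectrum_real a
  have hc : ∀ f : ℝ → ℝ, ContinuousOn f (spectrum ℝ a) := fun f => hfin.continuousOn f
  let f : ℝ → ℝ → ℝ := fun μ t => if t = μ then 1 else 0
  refine ⟨hfin.toFinset, fun μ => cfc (f μ) a, ?_, ?_, ?_, ?_, ?_⟩
  · intro μ
    refine ⟨?_, cfc_predicate _ _⟩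
    change cfc (f μ) a * cfc (f μ) a = cfc (f μ) a
    rw [← cfc_mul _ _ a (hc _) (hc _)]
    exact cfc_congr fun t _ => by simp [f]
  · intro μ ν h
    change cfc (f μ) a * cfc (f ν) a = 0
    rw [← cfc_mul _ _ a (hc _) (hc _), ← cfc_zero (R := ℝ) a]
    exact cfc_congr fun t _ => by simp only [f, Pi.zero_apply]; grind
  · change ∑ μ ∈ _, cfc (f μ) a = 1
    rw [← cfc_sum f a _ (fun i _ => hc _), ← cfc_one (R := ℝ) a]
    refine cfc_congr fun t ht => ?_
    simp [f, ht]
  · intro μ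
    change a * cfc (f μ) a = μ • cfc (f μ) a
    conv_lhs => enter [1]; rw [← cfc_id' ℝ a]
    rw [← cfc_mul _ _ a (hc _) (hc _), ← cfc_smul _ _ _ (hc _)]
    exact cfc_congr fun t _ => by simp only [f, smul_eq_mul]; grind
  · intro x hx μ
    exact hx.cfc_real _

/-- A projection whose corner is not one-dimensional has a proper nonzero subprojection. -/
lemma exists_proper_subprojection [FiniteDimensional ℂ F] {p : F} (hp : IsStarProjection p)
    (hp0 : p ≠ 0) (hmin : ¬ IsMinimalProjection p) :
    ∃ q : F, IsStarProjection q ∧ p * q = q ∧ q * p = q ∧ q ≠ 0 ∧ q ≠ p := by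
  have hpp : p * p = p := hp.isIdempotentElem
  have hps : star p = p := hp.isSelfAdjoint
  have hx : ∃ x : F, ∀ t : ℂ, p * x * p ≠ t • p := by
    by_contra hcon
    push Not at hcon
    exact hmin ⟨hp, hp0, hcon⟩
  obtain ⟨x, hx⟩ := hx
  have ha : ∃ a : F, IsSelfAdjoint a ∧ ∀ t : ℂ, p * a * p ≠ t • p := by
    by_contra hcon
    push Not at hcon
    obtain ⟨t₁, h₁⟩ := hcon (realPart x) (realPart x).2
    obtain ⟨t₂, h₂⟩ := hcon (imaginaryPart x) (imaginaryPart x).2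
    apply hx (t₁ + Complex.I * t₂)
    conv_lhs => rw [← realPart_add_I_smul_imaginaryPart x]
    rw [mul_add, add_mul, h₁, mul_smul_comm, smul_mul_assoc, h₂, add_smul, mul_smul]
  obtain ⟨y, hy, hyt⟩ := ha
  set a := p * y * p with ha_def
  have ha : IsSelfAdjoint a := by
    simp [ha_def, isSelfAdjoint_iff, hps, hy.star_eq, mul_assoc]
  have hpa : p * a = a := by simp only [ha_def, ← mul_assoc, hpp]
  have hap : a * p = a := by simp only [ha_def, mul_assoc, hpp]
  obtain ⟨s, q, hq, -, hq1, haq, hqc⟩ := exists_spectral_projections ha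
  have hcp : ∀ μ, Commute (q μ) p := hqc p (by rw [Commute, SemiconjBy, hpa, hap])
  by_contra hcon
  push Not at hcon
  -- Otherwise each product `p * q μ` of commuting projections is `0` or `p`.
  have hor : ∀ μ, p * q μ = 0 ∨ p * q μ = p := by
    intro μ
    by_contra h
    push Not at h
    have h2 : p * q μ * p = p * q μ := by rw [mul_assoc, (hcp μ).eq, ← mul_assoc, hpp]
    refine h.2 (hcon (p * q μ) ?_ ?_ h2 h.1)
    · exact hp.mul (hq μ) (hcp μ).symm
    · rw [← mul_assoc, hpp]
  have h1 : ∃ μ, p * q μ = p := by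
    by_contra h
    push Not at h
    apply hp0
    rw [← mul_one p, ← hq1, Finset.mul_sum]
    exact Finset.sum_eq_zero fun μ _ => (hor μ).resolve_right (h μ)
  obtain ⟨μ, hμ⟩ := h1
  have h2 : a * q μ = a := by rw [← hap, mul_assoc, hμ]
  have h5 : p * (a * q μ) = μ • (p * q μ) := by rw [haq, mul_smul_comm]
  rw [h2, hpa, hμ] at h5
  exact hyt μ (by simpa using h5)

/-- Every projection is the sum of a finite set of pairwise orthogonal minimal projections. -/
lemma exists_minimal_decomposition [FiniteDimensional ℂ F] {p : F} (hp : IsStarProjection p) :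
    ∃ s : Finset F, (∀ e ∈ s, IsMinimalProjection e ∧ p * e = e ∧ e * p = e) ∧
      (∀ e ∈ s, ∀ f ∈ s, e ≠ f → e * f = 0) ∧ ∑ e ∈ s, e = p := by
  classical
  induction hn : Module.finrank ℂ (LinearMap.range (LinearMap.mulLeft ℂ p)) using
    Nat.strong_induction_on generalizing p with
  | _ n ih =>
    by_cases hp0 : p = 0
    · exact ⟨∅, by simp, by simp, by simp [hp0]⟩
    by_cases hmin : IsMinimalProjection p
    · exact ⟨{p}, by simp [hmin, hp.isIdempotentElem.eq], by simp +contextual, by simp⟩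
    have hpp : p * p = p := hp.isIdempotentElem
    have hlt : ∀ q : F, p * q = q → q * p = q → q ≠ p → IsIdempotentElem q →
        Module.finrank ℂ (LinearMap.range (LinearMap.mulLeft ℂ q)) < n := by
      intro q h1 h2 h3 h4
      rw [← hn]
      apply Submodule.finrank_lt_finrank_of_lt
      refine lt_of_le_of_ne ?_ ?_
      · rintro _ ⟨x, rfl⟩
        exact ⟨q * x, by simp [← mul_assoc, h1]⟩
      · intro h
        have : p ∈ LinearMap.range (LinearMap.mulLeft ℂ q) := by
          rw [h]; exact ⟨p, by simp [hpp]⟩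
        obtain ⟨x, hx⟩ := this
        apply h3
        have hx' : q * x = p := hx
        rw [← h2, ← hx', ← mul_assoc, h4.eq]
    obtain ⟨q, hq, hpq, hqp, hq0, hqne⟩ := exists_proper_subprojection hp hp0 hmin
    have hqq : q * q = q := hq.isIdempotentElem
    have hr : IsStarProjection (p - q) := by
      refine ⟨?_, hp.isSelfAdjoint.sub hq.isSelfAdjoint⟩
      simp [IsIdempotentElem, mul_sub, sub_mul, hpp, hpq, hqp, hqq]
    obtain ⟨s₁, a₁, b₁, c₁⟩ := ih _ (hlt q hpq hqp hqne hqq) hq rfl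
    obtain ⟨s₂, a₂, b₂, c₂⟩ := ih _ (hlt (p - q) (by simp [mul_sub, hpp, hpq])
      (by simp [sub_mul, hpp, hqp]) (by simpa using hq0) hr.isIdempotentElem) hr rfl
    have h12 : ∀ e ∈ s₁, ∀ f ∈ s₂, e * f = 0 := by
      intro e he f hf
      rw [← (a₁ e he).2.2, ← (a₂ f hf).2.1, mul_assoc, ← mul_assoc q, mul_sub, hqp, hqq]
      simp
    have h21 : ∀ e ∈ s₁, ∀ f ∈ s₂, f * e = 0 := by
      intro e he f hf
      rw [← (a₁ e he).2.1, ← (a₂ f hf).2.2, mul_assoc, ← mul_assoc _ q, sub_mul, hpq, hqq]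
      simp
    refine ⟨s₁ ∪ s₂, ?_, ?_, ?_⟩
    · intro e he
      rcases Finset.mem_union.mp he with he | he
      · obtain ⟨h1, h2, h3⟩ := a₁ e he
        refine ⟨h1, ?_, ?_⟩
        · rw [← h2, ← mul_assoc, hpq]
        · rw [← h3, mul_assoc, hqp]
      · obtain ⟨h1, h2, h3⟩ := a₂ e he
        refine ⟨h1, ?_, ?_⟩
        · rw [← h2, ← mul_assoc, mul_sub, hpp, hpq]
        · rw [← h3, mul_assoc, sub_mul, hpp, hqp]
    · intro e he f hf hne
      rcases Finset.mem_union.mp he with he | he <;> rcases Finset.mem_union.mp hf with hf | hf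
      · exact b₁ e he f hf hne
      · exact h12 e he f hf
      · exact h21 f hf e he
      · exact b₂ e he f hf hne
    · rw [Finset.sum_union, c₁, c₂]
      · abel
      · rw [Finset.disjoint_left]
        intro e he he'
        apply (a₁ e he).1.ne_zero
        rw [← (a₁ e he).1.isStarProjection.isIdempotentElem.eq, h12 e he e he']

/-- A self-adjoint element is diagonal with respect to some maximal family of pairwise orthogonal
minimal projections. -/
lemma exists_diagonalization [FiniteDimensional ℂ F] {a : F} (ha : IsSelfAdjoint a) :
    ∃ (s : Finset F) (l : F → ℝ), (∀ e ∈ s, IsMinimalProjection e) ∧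
      (∀ e ∈ s, ∀ f ∈ s, e ≠ f → e * f = 0) ∧ ∑ e ∈ s, e = 1 ∧ ∀ e ∈ s, a * e = l e • e := by
  classical
  obtain ⟨σ, q, hq, hq0, hq1, haq, -⟩ := exists_spectral_projections ha
  choose S hS hS0 hS1 using fun μ => exists_minimal_decomposition (hq μ)
  have hort : ∀ μ ν, μ ≠ ν → ∀ e ∈ S μ, ∀ f ∈ S ν, e * f = 0 := by
    intro μ ν h e he f hf
    rw [← (hS μ e he).2.2, ← (hS ν f hf).2.1, mul_assoc, ← mul_assoc (q μ), hq0 μ ν h]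
    simp
  have hdisj : ∀ μ ν, μ ≠ ν → Disjoint (S μ) (S ν) := by
    intro μ ν h
    rw [Finset.disjoint_left]
    intro e he he'
    apply (hS μ e he).1.ne_zero
    rw [← (hS μ e he).1.isStarProjection.isIdempotentElem.eq, hort μ ν h e he e he']
  have hl : ∀ e ∈ σ.biUnion S, ∃ t : ℝ, a * e = t • e := by
    intro e he
    obtain ⟨μ, -, he⟩ := Finset.mem_biUnion.mp he
    exact ⟨μ, by rw [← (hS μ e he).2.1, ← mul_assoc, haq, smul_mul_assoc]⟩
  choose! l hl using hl
  refine ⟨σ.biUnion S, l, ?_, ?_, ?_, hl⟩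
  · intro e he
    obtain ⟨μ, -, he⟩ := Finset.mem_biUnion.mp he
    exact (hS μ e he).1
  · intro e he f hf hne
    obtain ⟨μ, -, he⟩ := Finset.mem_biUnion.mp he
    obtain ⟨ν, -, hf⟩ := Finset.mem_biUnion.mp hf
    by_cases h : μ = ν
    · subst h; exact hS0 μ e he f hf hne
    · exact hort μ ν h e he f hf
  · rw [Finset.sum_biUnion fun μ _ ν _ h => hdisj μ ν h, ← hq1]
    exact Finset.sum_congr rfl fun μ _ => hS1 μ

end FiniteDimensional

/-! ### Order zero maps on finite-dimensional C⋆-algebras -/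

section OrderZero

variable {F A : Type*} [CStarAlgebra F] [PartialOrder F] [StarOrderedRing F]
  [NonUnitalCStarAlgebra A] [PartialOrder A] [StarOrderedRing A] {φ : F →CP A}

lemma CompletelyPositiveMap.isSelfAdjoint_map_one (φ : F →CP A) : IsSelfAdjoint (φ 1) := by
  rw [isSelfAdjoint_iff, ← map_star, star_one]

lemma CompletelyPositiveMap.map_one_nonneg (φ : F →CP A) : 0 ≤ φ 1 := map_nonneg φ zero_le_one

lemma IsOrderZero.map_projection_mul_map_one (hφ : IsOrderZero φ) {p : F}
    (hp : IsStarProjection p) : φ p * φ 1 = φ p * φ p := by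
  have := hφ p (1 - p) hp.nonneg hp.one_sub.nonneg hp.mul_one_sub_self
  rwa [map_sub, mul_sub, sub_eq_zero] at this

lemma IsOrderZero.map_one_mul_map_projection (hφ : IsOrderZero φ) {p : F}
    (hp : IsStarProjection p) : φ 1 * φ p = φ p * φ p := by
  have := hφ (1 - p) p hp.one_sub.nonneg hp.nonneg hp.one_sub_mul_self
  rwa [map_sub, sub_mul, sub_eq_zero] at this

variable [FiniteDimensional ℂ F]

lemma IsOrderZero.map_selfAdjoint (hφ : IsOrderZero φ) {a : F} (ha : IsSelfAdjoint a) :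
    φ 1 * φ a = φ a * φ 1 ∧ φ a * φ a = φ 1 * φ (a * a) := by
  obtain ⟨s, l, hs, ho, h1, hl⟩ := exists_diagonalization ha
  have ha : a = ∑ e ∈ s, l e • e := by
    rw [← mul_one a, ← h1, Finset.mul_sum]
    exact Finset.sum_congr rfl hl
  have haa : a * a = ∑ e ∈ s, (l e * l e) • e := by
    conv_lhs => rw [← mul_one (a * a), ← h1, Finset.mul_sum]
    exact Finset.sum_congr rfl fun e he => by
      rw [mul_assoc, hl e he, mul_smul_comm, hl e he, smul_smul]
  have hsm : ∀ (r : ℝ) (x : F), φ (r • x) = r • φ x := fun r x => by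
    rw [← Complex.coe_smul, map_smul, Complex.coe_smul]
  have hφa : φ a = ∑ e ∈ s, l e • φ e := by simp [ha, map_sum, hsm]
  have hφaa : φ (a * a) = ∑ e ∈ s, (l e * l e) • φ e := by simp only [haa, map_sum, hsm]
  have hp := fun e he => hφ.map_projection_mul_map_one (hs e he).isStarProjection
  have hp' := fun e he => hφ.map_one_mul_map_projection (hs e he).isStarProjection
  refine ⟨?_, ?_⟩
  · rw [hφa, Finset.mul_sum, Finset.sum_mul]
    exact Finset.sum_congr rfl fun e he => by
      rw [mul_smul_comm, smul_mul_assoc, hp e he, hp' e he]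
  · rw [hφaa, hφa, Finset.sum_mul, Finset.mul_sum]
    refine Finset.sum_congr rfl fun e he => ?_
    rw [Finset.mul_sum, Finset.sum_eq_single e]
    · simp only [mul_smul_comm, smul_mul_assoc, smul_smul, hp' e he]
    · intro f hf hne
      rw [smul_mul_assoc, mul_smul_comm,
        hφ e f (hs e he).isStarProjection.nonneg (hs f hf).isStarProjection.nonneg
          (ho e he f hf hne.symm), smul_zero, smul_zero]
    · exact fun h => (h he).elim

lemma IsOrderZero.map_one_commute (hφ : IsOrderZero φ) (a : F) :
    φ 1 * φ a = φ a * φ 1 := by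
  rw [← realPart_add_I_smul_imaginaryPart a, map_add, map_smul, mul_add, add_mul, mul_smul_comm,
    smul_mul_assoc, (hφ.map_selfAdjoint (realPart a).2).1,
    (hφ.map_selfAdjoint (imaginaryPart a).2).1]

/-- An order zero map is multiplicative up to the factor `φ 1`. For self-adjoint `a` this is the
Cauchy–Schwarz inequality for the vector `a ⊗ φ(1) - 1 ⊗ φ(a)`, which has length zero. -/
lemma IsOrderZero.map_mul_map (hφ : IsOrderZero φ) (a b : F) :
    φ a * φ b = φ 1 * φ (a * b) := by
  have key : ∀ a : F, IsSelfAdjoint a → φ a * φ b = φ 1 * φ (a * b) := by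
    intro a ha
    obtain ⟨h1, h2⟩ := hφ.map_selfAdjoint ha
    have hφa : star (φ a) = φ a := by rw [← map_star, ha.star_eq]
    have hc : star (φ 1) = φ 1 := φ.isSelfAdjoint_map_one
    have hcaa := hφ.map_one_commute (a * a)
    have hY := CStarAlgebra.norm_sq_le_of_form_nonneg (P := 0)
      (Y := φ 1 * φ (a * b) - φ a * φ b) (Q := φ (star b * b))
      (by rw [isSelfAdjoint_iff, ← map_star]; simp) ?_
    · rw [norm_zero, zero_mul] at hY
      have h0 : ‖φ 1 * φ (a * b) - φ a * φ b‖ = 0 := by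
        have := norm_nonneg (φ 1 * φ (a * b) - φ a * φ b)
        nlinarith
      rw [norm_eq_zero, sub_eq_zero] at h0
      exact h0.symm
    · intro g g'
      have h := φ.three_nonneg a 1 b (φ 1 * g) (-(φ a * g)) g'
      convert h using 1
      simp only [star_sub, star_mul, star_neg, ha.star_eq, hφa, hc, star_one, one_mul, mul_one, ← map_star]
      have e1 : star g * φ 1 * φ (a * a) * (φ 1 * g) = star g * (φ 1 * φ (a * a)) * (φ 1 * g) := by
        noncomm_ring
      have e2 : star g * φ 1 * φ a * -(φ a * g) = - (star g * φ 1 * (φ a * φ a) * g) := by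
        noncomm_ring
      have e3 : -(star g * φ a) * φ a * (φ 1 * g) = -(star g * (φ a * φ a) * φ 1 * g) := by
        noncomm_ring
      have e4 : -(star g * φ a) * φ 1 * -(φ a * g) = star g * (φ a * φ 1) * φ a * g := by
        noncomm_ring
      have e5 : star g * (φ 1 * φ a) * φ a * g = star g * φ 1 * (φ a * φ a) * g := by
        noncomm_ring
      have e6 : star g * (φ 1 * φ (a * a)) * φ 1 * g = star g * φ 1 * (φ (a * a) * φ 1) * g := by
        noncomm_ring
      have e7 : star g * (φ 1 * φ (a * a)) * (φ 1 * g)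
          = star g * (φ 1 * φ (a * a)) * φ 1 * g := by noncomm_ring
      rw [e1, e2, e3, e4, ← h1, e5, h2, e7, e6, ← hcaa]
      noncomm_ring
  rw [← realPart_add_I_smul_imaginaryPart a, map_add, map_smul, add_mul, add_mul,
    smul_mul_assoc, smul_mul_assoc, map_add, map_smul, mul_add, mul_smul_comm,
    key _ (realPart a).2, key _ (imaginaryPart a).2]

/-- Order zero maps see minimal projections without loss: the norm of `x p` can be read off from
`φ x` once `φ p` is bounded below. -/
lemma IsOrderZero.norm_mul_minimal_le (hφ : IsOrderZero φ) {p : F} (hp : IsMinimalProjection p)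
    (x : F) : ‖φ p‖ ^ 2 * ‖x * p‖ ≤ ‖φ x * φ 1‖ := by
  have hpp : p * p = p := hp.isStarProjection.isIdempotentElem
  have hps : star p = p := hp.isStarProjection.isSelfAdjoint
  obtain ⟨t, ht⟩ := hp.corner (star x * x)
  set q := φ p with hq
  have hqs : star q = q := by rw [hq, ← map_star, hps]
  have hn2 : ∀ y : A, star y = y → ‖y * y‖ = ‖y‖ ^ 2 := fun y hy => by
    have := CStarRing.norm_star_mul_self (x := y)
    rw [hy] at this; rw [this, sq]
  have hvv : star (x * p) * (x * p) = t • p := by rw [← ht, star_mul, hps]; noncomm_ring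
  have hp1 : ‖p‖ = 1 := hp.norm_eq_one
  have hv : ‖x * p‖ ^ 2 = ‖t‖ := by
    rw [sq, ← CStarRing.norm_star_mul_self, hvv, norm_smul, hp1, mul_one]
  have hcq : φ 1 * q = q * q := hφ.map_one_mul_map_projection hp.isStarProjection
  have hqc : q * φ 1 = q * q := hφ.map_projection_mul_map_one hp.isStarProjection
  set v := φ (x * p) with hvdef
  have hvq : v * q = φ 1 * v := by rw [hφ.map_mul_map, mul_assoc, hpp]
  have hW : φ x * φ 1 * q = v * q * q := by
    rw [mul_assoc, hcq, ← mul_assoc, hφ.map_mul_map, ← hvdef, hvq]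
  have hsvv : star v * v = t • (q * q) := by
    rw [← map_star, hφ.map_mul_map, hvv, map_smul, mul_smul_comm, hcq]
  have hWW : star (φ x * φ 1 * q) * (φ x * φ 1 * q) = t • (q * q * (q * q) * (q * q)) := by
    rw [hW]
    simp only [star_mul, hqs]
    calc q * (q * star v) * (v * q * q) = q * q * (star v * v) * (q * q) := by noncomm_ring
      _ = _ := by rw [hsvv, mul_smul_comm, smul_mul_assoc]
  have h8 : ‖q‖ ^ 8 ≤ ‖q * q * (q * q) * (q * q)‖ * ‖q‖ ^ 2 := by
    have e1 : ‖q * q * (q * q) * (q * q * (q * q))‖ = ‖q‖ ^ 8 := by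
      rw [hn2 _ (by simp [hqs]), hn2 _ (by simp [hqs]), hn2 _ hqs]; ring
    rw [← e1, ← hn2 q hqs, ← mul_assoc]
    exact norm_mul_le _ _
  have hWn : ‖t‖ * ‖q * q * (q * q) * (q * q)‖ ≤ (‖φ x * φ 1‖ * ‖q‖) ^ 2 := by
    rw [← norm_smul, ← hWW, CStarRing.norm_star_mul_self, ← sq]
    gcongr
    exact norm_mul_le _ _
  rcases (norm_nonneg q).eq_or_lt with h0 | h0
  · rw [← h0]; simp
  refine le_of_sq_le_sq ?_ (norm_nonneg _)
  have h9 : (‖q‖ ^ 2 * ‖x * p‖) ^ 2 * ‖q‖ ^ 4 ≤ ‖φ x * φ 1‖ ^ 2 * ‖q‖ ^ 4 := by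
    calc (‖q‖ ^ 2 * ‖x * p‖) ^ 2 * ‖q‖ ^ 4 = ‖t‖ * ‖q‖ ^ 8 := by rw [← hv]; ring
      _ ≤ ‖t‖ * (‖q * q * (q * q) * (q * q)‖ * ‖q‖ ^ 2) := by gcongr
      _ ≤ (‖φ x * φ 1‖ * ‖q‖) ^ 2 * ‖q‖ ^ 2 := by rw [← mul_assoc]; gcongr
      _ = _ := by ring
  exact le_of_mul_le_mul_right h9 (by positivity)

end OrderZero

/-! ### Traces of blocks -/

section Blocks

variable {F : Type*} [CStarAlgebra F]

open Classical in
/-- The scalar `t` with `p x p = t p`, for a minimal projection `p`; zero if there is none. -/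
noncomputable def cornerCoeff (p x : F) : ℂ :=
  if h : ∃ t : ℂ, p * x * p = t • p then h.choose else 0

namespace IsMinimalProjection

variable {p q : F}

lemma mul_self (hp : IsMinimalProjection p) : p * p = p := hp.isStarProjection.isIdempotentElem

lemma star_eq (hp : IsMinimalProjection p) : star p = p := hp.isStarProjection.isSelfAdjoint

lemma mul_mul_eq (hp : IsMinimalProjection p) (x : F) :
    p * x * p = cornerCoeff p x • p := by
  have h := hp.corner x
  rw [cornerCoeff, dif_pos h]
  exact h.choose_spec

lemma cornerCoeff_eq (hp : IsMinimalProjection p) {x : F} {t : ℂ} (h : p * x * p = t • p) :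
    cornerCoeff p x = t := by
  rw [hp.mul_mul_eq] at h
  exact smul_left_injective ℂ hp.ne_zero h

lemma cornerCoeff_add (hp : IsMinimalProjection p) (x y : F) :
    cornerCoeff p (x + y) = cornerCoeff p x + cornerCoeff p y :=
  hp.cornerCoeff_eq <| by rw [mul_add, add_mul, hp.mul_mul_eq, hp.mul_mul_eq, add_smul]

lemma cornerCoeff_smul (hp : IsMinimalProjection p) (t : ℂ) (x : F) :
    cornerCoeff p (t • x) = t * cornerCoeff p x :=
  hp.cornerCoeff_eq <| by rw [mul_smul_comm, smul_mul_assoc, hp.mul_mul_eq, mul_smul]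

lemma norm_cornerCoeff_le (hp : IsMinimalProjection p) (x : F) :
    ‖cornerCoeff p x‖ ≤ ‖x * p‖ := by
  have h : ‖cornerCoeff p x • p‖ ≤ ‖p‖ * ‖x * p‖ := by
    rw [← hp.mul_mul_eq, mul_assoc]; exact norm_mul_le _ _
  rwa [norm_smul, hp.norm_eq_one, mul_one, one_mul] at h

lemma cornerCoeff_mul_comm (hp : IsMinimalProjection p) (hq : IsMinimalProjection q) (x y : F) :
    cornerCoeff p (x * q * y) = cornerCoeff q (y * p * x) := by
  have h1 : p * (x * q * y) * p = (p * x * q) * (q * y * p) := by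
    have := hq.mul_self
    simp only [mul_assoc]; rw [← mul_assoc q q, this]
  have h2 : q * (y * p * x) * q = (q * y * p) * (p * x * q) := by
    have := hp.mul_self
    simp only [mul_assoc]; rw [← mul_assoc p p, this]
  rw [hp.mul_mul_eq] at h1
  rw [hq.mul_mul_eq] at h2
  -- With `u = p x q` and `w = q y p`, compute `u w u` in two ways.
  have h3 : cornerCoeff p (x * q * y) • (p * x * q) = cornerCoeff q (y * p * x) • (p * x * q) := by
    calc _ = (cornerCoeff p (x * q * y) • p) * (p * x * q) := by
          rw [smul_mul_assoc, ← mul_assoc, ← mul_assoc, hp.mul_self]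
      _ = (p * x * q) * (cornerCoeff q (y * p * x) • q) := by rw [h1, h2, mul_assoc]
      _ = _ := by rw [mul_smul_comm, mul_assoc _ q q, hq.mul_self]
  by_cases hu : p * x * q = 0
  · rw [hu, zero_mul] at h1
    rw [hu, mul_zero] at h2
    rw [(smul_eq_zero.mp h1).resolve_right hp.ne_zero,
      (smul_eq_zero.mp h2).resolve_right hq.ne_zero]
  · exact smul_left_injective ℂ hu h3

end IsMinimalProjection

/-- A finite set of pairwise orthogonal minimal projections with central sum. The sum cuts out
a direct summand of `F`, a union of simple blocks, on which `blockTrace` is a trace. -/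
structure IsBlock (C : Finset F) : Prop where
  minimal : ∀ p ∈ C, IsMinimalProjection p
  orthogonal : ∀ p ∈ C, ∀ q ∈ C, p ≠ q → p * q = 0
  central : ∀ x : F, (∑ p ∈ C, p) * x = x * ∑ p ∈ C, p

/-- The unnormalized trace `∑ p ∈ C, τ_p`, where `p x p = τ_p(x) p`. -/
noncomputable def blockTrace (C : Finset F) (x : F) : ℂ := ∑ p ∈ C, cornerCoeff p x

namespace IsBlock

variable {C : Finset F}

lemma blockTrace_add (hC : IsBlock C) (x y : F) :
    blockTrace C (x + y) = blockTrace C x + blockTrace C y := by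
  rw [blockTrace, blockTrace, blockTrace, ← Finset.sum_add_distrib]
  exact Finset.sum_congr rfl fun p hp => (hC.minimal p hp).cornerCoeff_add x y

lemma blockTrace_smul (hC : IsBlock C) (t : ℂ) (x : F) :
    blockTrace C (t • x) = t * blockTrace C x := by
  rw [blockTrace, blockTrace, Finset.mul_sum]
  exact Finset.sum_congr rfl fun p hp => (hC.minimal p hp).cornerCoeff_smul t x

lemma blockTrace_zero (hC : IsBlock C) : blockTrace C 0 = 0 := by
  rw [← zero_smul ℂ (0 : F), hC.blockTrace_smul, zero_mul]

lemma blockTrace_sub (hC : IsBlock C) (x y : F) :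
    blockTrace C (x - y) = blockTrace C x - blockTrace C y := by
  rw [sub_eq_add_neg, hC.blockTrace_add, ← neg_one_smul ℂ y, hC.blockTrace_smul]
  ring

lemma blockTrace_sum (hC : IsBlock C) {ι : Type*} (s : Finset ι) (f : ι → F) :
    blockTrace C (∑ i ∈ s, f i) = ∑ i ∈ s, blockTrace C (f i) :=
  map_sum (AddMonoidHom.mk' (blockTrace C) hC.blockTrace_add) f s

lemma norm_blockTrace_le (hC : IsBlock C) {x : F} {r : ℝ} (h : ∀ p ∈ C, ‖x * p‖ ≤ r) :
    ‖blockTrace C x‖ ≤ C.card * r := by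
  rw [← nsmul_eq_mul, ← Finset.sum_const]
  exact norm_sum_le_of_le C fun p hp => ((hC.minimal p hp).norm_cornerCoeff_le x).trans (h p hp)

lemma norm_blockTrace_le_norm (hC : IsBlock C) (x : F) :
    ‖blockTrace C x‖ ≤ C.card * ‖x‖ :=
  hC.norm_blockTrace_le fun p hp => (norm_mul_le _ _).trans_eq <| by
    rw [(hC.minimal p hp).norm_eq_one, mul_one]

lemma blockTrace_mul_comm (hC : IsBlock C) (x y : F) :
    blockTrace C (x * y) = blockTrace C (y * x) := by
  have key : ∀ x y : F, ∀ p ∈ C, cornerCoeff p (x * y) = ∑ q ∈ C, cornerCoeff p (x * q * y) := by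
    intro x y p hp
    have hm := hC.minimal p hp
    apply hm.cornerCoeff_eq
    have hpz : p * ∑ q ∈ C, q = p := by
      rw [Finset.mul_sum, Finset.sum_eq_single p (fun q hq hne => hC.orthogonal p hp q hq hne.symm)
        (fun h => (h hp).elim), hm.mul_self]
    rw [Finset.sum_smul]
    calc p * (x * y) * p = p * (∑ q ∈ C, q) * x * y * p := by rw [hpz]; noncomm_ring
      _ = p * (x * (∑ q ∈ C, q) * y) * p := by
          rw [mul_assoc p, hC.central x]; noncomm_ring
      _ = _ := by
        rw [Finset.mul_sum, Finset.sum_mul, Finset.mul_sum, Finset.sum_mul]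
        exact Finset.sum_congr rfl fun q _ => hm.mul_mul_eq _
  rw [blockTrace, blockTrace, Finset.sum_congr rfl (key x y), Finset.sum_congr rfl (key y x),
    Finset.sum_comm]
  exact Finset.sum_congr rfl fun q hq => Finset.sum_congr rfl fun p hp =>
    (hC.minimal p hp).cornerCoeff_mul_comm (hC.minimal q hq) x y

end IsBlock

/-! ### Equivalence of minimal projections -/

/-- Two projections are linked if some element of `F` maps one nontrivially into the other; for
minimal projections this is Murray–von Neumann equivalence. -/
def Linked (p q : F) : Prop := ∃ u : F, p * u * q ≠ 0

namespace Linked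

variable {p q r : F}

lemma refl (hp : IsMinimalProjection p) : Linked p p :=
  ⟨1, by rw [mul_one, hp.mul_self]; exact hp.ne_zero⟩

lemma symm (hp : IsStarProjection p) (hq : IsStarProjection q) (h : Linked p q) :
    Linked q p := by
  obtain ⟨u, hu⟩ := h
  refine ⟨star u, fun h0 => hu ?_⟩
  rw [← star_eq_zero, star_mul, star_mul, hp.isSelfAdjoint.star_eq, hq.isSelfAdjoint.star_eq,
    ← mul_assoc, h0]

/-- Linked minimal projections are connected by a partial isometry. -/
lemma exists_partialIsometry (hp : IsMinimalProjection p) (hq : IsMinimalProjection q)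
    (h : Linked p q) : ∃ w : F, p * w = w ∧ w * q = w ∧ star w * w = q ∧ w * star w = p := by
  obtain ⟨u, hu⟩ := h
  obtain ⟨v, hv⟩ : ∃ v, v = p * u * q := ⟨_, rfl⟩
  rw [← hv] at hu
  have hpv : p * v = v := by simp only [hv, ← mul_assoc, hp.mul_self]
  have hvq : v * q = v := by simp only [hv, mul_assoc, hq.mul_self]
  have hqsv : q * star v = star v := by rw [← hq.star_eq, ← star_mul, hvq]
  have hsvp : star v * p = star v := by rw [← hp.star_eq, ← star_mul, hpv]
  have h1 : ∃ t : ℂ, star v * v = t • q := by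
    obtain ⟨t, ht⟩ := hq.corner (star v * v)
    exact ⟨t, by rw [← ht, ← mul_assoc, hqsv, mul_assoc, hvq]⟩
  have h2 : ∃ t : ℂ, v * star v = t • p := by
    obtain ⟨t, ht⟩ := hp.corner (v * star v)
    exact ⟨t, by rw [← ht, ← mul_assoc, hpv, mul_assoc, hsvp]⟩
  obtain ⟨t, ht⟩ := h1
  obtain ⟨t', ht'⟩ := h2
  have htt' : t = t' := by
    have : v * (star v * v) = v * star v * v := (mul_assoc _ _ _).symm
    rw [ht, ht', mul_smul_comm, smul_mul_assoc, hvq, hpv] at this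
    exact smul_left_injective ℂ hu this
  -- The scalar `t` is positive, being the eigenvalue of `v* v` on `q`.
  have htn : t = ((‖v‖ ^ 2 : ℝ) : ℂ) := by
    let _ := CStarAlgebra.spectralOrder F
    have _ := CStarAlgebra.spectralOrderedRing F
    have h0 : 0 ≤ t • q := ht ▸ star_mul_self_nonneg v
    have hsa : star t • q = t • q := by
      have := h0.isSelfAdjoint.star_eq
      rwa [star_smul, hq.star_eq] at this
    have hre : star t = t := smul_left_injective ℂ hq.ne_zero hsa
    have hn : ‖t‖ = ‖v‖ ^ 2 := by
      rw [sq, ← CStarRing.norm_star_mul_self, ht, norm_smul, hq.norm_eq_one, mul_one]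
    obtain ⟨r, rfl⟩ := Complex.conj_eq_iff_real.mp hre
    rw [← hn, Complex.norm_real, Real.norm_eq_abs, abs_of_nonneg]
    by_contra hneg
    push Not at hneg
    have h3 : 0 ≤ (-r) • q := smul_nonneg (by linarith) hq.isStarProjection.nonneg
    have h4 : (r : ℂ) • q = 0 := by
      apply le_antisymm _ h0
      rw [neg_smul] at h3
      simpa using h3
    rcases smul_eq_zero.mp h4 with h5 | h5
    · exact hneg.ne (by exact_mod_cast h5)
    · exact hq.ne_zero h5
  have hvn : (‖v‖ : ℂ) ≠ 0 := by simpa using hu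
  refine ⟨(‖v‖ : ℂ)⁻¹ • v, ?_, ?_, ?_, ?_⟩
  · rw [mul_smul_comm, hpv]
  · rw [smul_mul_assoc, hvq]
  · rw [star_smul, smul_mul_smul_comm, ht, smul_smul, htn]
    simp only [star_inv₀, Complex.star_def, Complex.conj_ofReal]
    push_cast
    rw [show (‖v‖ : ℂ)⁻¹ * (‖v‖ : ℂ)⁻¹ * (‖v‖ : ℂ) ^ 2 = 1 by field_simp, one_smul]
  · rw [star_smul, smul_mul_smul_comm, ht', smul_smul, ← htt', htn]
    simp only [star_inv₀, Complex.star_def, Complex.conj_ofReal]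
    push_cast
    rw [show (‖v‖ : ℂ)⁻¹ * (‖v‖ : ℂ)⁻¹ * (‖v‖ : ℂ) ^ 2 = 1 by field_simp, one_smul]

lemma trans (hp : IsMinimalProjection p) (hq : IsMinimalProjection q)
    (hr : IsMinimalProjection r) (h1 : Linked p q) (h2 : Linked q r) : Linked p r := by
  obtain ⟨v, hpv, hvq, hv, hv'⟩ := h1.exists_partialIsometry hp hq
  obtain ⟨w, hqw, hwr, hw, hw'⟩ := h2.exists_partialIsometry hq hr
  refine ⟨v * w, fun h0 => hp.ne_zero ?_⟩
  have h3 : v * w = 0 := by rw [← h0, ← mul_assoc p, hpv, mul_assoc, hwr]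
  calc p = v * star v := hv'.symm
    _ = v * (w * star w) * star v := by rw [hw', hvq]
    _ = v * w * star w * star v := by noncomm_ring
    _ = 0 := by rw [h3]; simp

end Linked

open Classical in
lemma isBlock_filter_linked {s : Finset F} (hs : ∀ e ∈ s, IsMinimalProjection e)
    (ho : ∀ e ∈ s, ∀ f ∈ s, e ≠ f → e * f = 0) (h1 : ∑ e ∈ s, e = 1) {p : F} (hp : p ∈ s) :
    IsBlock (s.filter (Linked p)) := by
  refine ⟨fun e he => hs e (Finset.mem_filter.mp he).1, fun e he f hf =>
    ho e (Finset.mem_filter.mp he).1 f (Finset.mem_filter.mp hf).1, fun x => ?_⟩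
  set z := ∑ e ∈ s with Linked p e, e
  set z' := ∑ e ∈ s with ¬ Linked p e, e
  have hz : z + z' = 1 := by rw [← h1]; exact Finset.sum_filter_add_sum_filter_not s _ _
  have h2 : z * x * z' = 0 := by
    rw [Finset.sum_mul, Finset.sum_mul]
    refine Finset.sum_eq_zero fun e he => ?_
    rw [Finset.mul_sum]
    refine Finset.sum_eq_zero fun f hf => ?_
    rw [Finset.mem_filter] at he hf
    by_contra hne
    exact hf.2 (he.2.trans (hs p hp) (hs e he.1) (hs f hf.1) ⟨x, hne⟩)
  have h3 : z' * x * z = 0 := by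
    rw [Finset.sum_mul, Finset.sum_mul]
    refine Finset.sum_eq_zero fun f hf => ?_
    rw [Finset.mul_sum]
    refine Finset.sum_eq_zero fun e he => ?_
    rw [Finset.mem_filter] at he hf
    by_contra hne
    have h4 : Linked f e := ⟨x, hne⟩
    exact hf.2 (he.2.trans (hs p hp) (hs e he.1) (hs f hf.1)
      (h4.symm (hs f hf.1).isStarProjection (hs e he.1).isStarProjection))
  calc z * x = z * x * (z + z') := by rw [hz, mul_one]
    _ = z * x * z := by rw [mul_add, h2, add_zero]
    _ = (z + z') * x * z := by rw [add_mul, add_mul, h3, add_zero]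
    _ = x * z := by rw [hz, one_mul]

end Blocks

/-! ### Diagonal elements of trace zero as sums of two commuting self-commutators -/

section Chain

variable {F : Type*} [CStarAlgebra F]

/-- The next projection of the chain: if `S` is nonzero it is linked to `q`, and its coefficient has
the sign opposite to that of `S`, so that partial sums stay in `[-M, M]`. -/
lemma exists_next {M S : ℝ} {C : Finset F} {l : F → ℝ} {q : F} (hC : C.Nonempty)
    (hmin : ∀ p ∈ C, IsMinimalProjection p) (hl : ∀ p ∈ C, |l p| ≤ M)
    (hq : q = 0 ∨ IsMinimalProjection q) (hS : |S| ≤ M) [DecidableEq F]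
    [∀ p : F, DecidablePred (Linked p)]
    (hsum : S + ∑ p ∈ C with Linked q p, l p = 0)
    (hsums : ∀ p ∈ C, ¬ Linked q p → ∑ p' ∈ C with Linked p p', l p' = 0) :
    ∃ j ∈ C, (S = 0 ∨ IsMinimalProjection q ∧ Linked q j) ∧ |S + l j| ≤ M ∧
      S + l j + ∑ p ∈ C.erase j with Linked j p, l p = 0 ∧
      ∀ p ∈ C.erase j, ¬ Linked j p → ∑ p' ∈ C.erase j with Linked p p', l p' = 0 := by
  have hsymm : ∀ p ∈ C, ∀ p' ∈ C, Linked p p' → Linked p' p := fun p hp p' hp' h =>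
    h.symm (hmin p hp).isStarProjection (hmin p' hp').isStarProjection
  have herase : ∀ j ∈ C, ∀ p ∈ C, ¬ Linked j p →
      ∑ p' ∈ C.erase j with Linked p p', l p' = ∑ p' ∈ C with Linked p p', l p' := by
    intro j hj p hp hjp
    rw [Finset.filter_erase, Finset.erase_eq_of_notMem]
    rw [Finset.mem_filter]
    exact fun h => hjp (hsymm p hp j hj h.2)
  have hself : ∀ j ∈ C, l j + ∑ p ∈ C.erase j with Linked j p, l p
      = ∑ p ∈ C with Linked j p, l p := by
    intro j hj
    rw [Finset.filter_erase]
    exact Finset.add_sum_erase _ _ (Finset.mem_filter.mpr ⟨hj, Linked.refl (hmin j hj)⟩)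
  by_cases hex : ∃ j ∈ C, Linked q j
  · have hqm : IsMinimalProjection q := by
      refine hq.resolve_left ?_
      rintro rfl
      obtain ⟨j, -, u, hu⟩ := hex
      simp at hu
    obtain ⟨j, hj, hqj, hsign⟩ : ∃ j ∈ C, Linked q j ∧ |S + l j| ≤ M := by
      have hne : (C.filter (Linked q)).Nonempty := by
        obtain ⟨j, hj, h⟩ := hex
        exact ⟨j, Finset.mem_filter.mpr ⟨hj, h⟩⟩
      rcases le_total 0 S with hS0 | hS0
      · obtain ⟨j, hj, hlj⟩ := Finset.exists_le_of_sum_le (f := l) (g := fun _ => 0) hne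
          (by rw [Finset.sum_const_zero]; linarith)
        rw [Finset.mem_filter] at hj
        have := abs_le.mp (hl j hj.1)
        have := abs_le.mp hS
        exact ⟨j, hj.1, hj.2, abs_le.mpr ⟨by linarith, by linarith⟩⟩
      · obtain ⟨j, hj, hlj⟩ := Finset.exists_le_of_sum_le (f := fun _ => 0) (g := l) hne
          (by rw [Finset.sum_const_zero]; linarith)
        rw [Finset.mem_filter] at hj
        have := abs_le.mp (hl j hj.1)
        have := abs_le.mp hS
        exact ⟨j, hj.1, hj.2, abs_le.mpr ⟨by linarith, by linarith⟩⟩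
    have hjm := hmin j hj
    have hjq : Linked j q := hqj.symm hqm.isStarProjection hjm.isStarProjection
    refine ⟨j, hj, Or.inr ⟨hqm, hqj⟩, hsign, ?_, ?_⟩
    · rw [add_assoc, hself j hj, ← hsum]
      congr 2
      refine Finset.filter_congr fun p hp => ⟨hqj.trans hqm hjm (hmin p hp),
        hjq.trans hjm hqm (hmin p hp)⟩
    · intro p hp hjp
      have hpC := Finset.mem_of_mem_erase hp
      rw [herase j hj p hpC hjp]
      exact hsums p hpC fun h => hjp (hjq.trans hjm hqm (hmin p hpC) h)
  · push Not at hex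
    have hS0 : S = 0 := by
      rwa [Finset.filter_false_of_mem hex, Finset.sum_empty, add_zero] at hsum
    obtain ⟨j, hj⟩ := hC
    refine ⟨j, hj, Or.inl hS0, by rw [hS0, zero_add]; exact hl j hj, ?_, ?_⟩
    · rw [hS0, zero_add, hself j hj]
      exact hsums j hj (hex j hj)
    · intro p hp hjp
      have hpC := Finset.mem_of_mem_erase hp
      rw [herase j hj p hpC hjp]
      exact hsums p hpC (hex p hpC)

variable [PartialOrder F] [StarOrderedRing F]

lemma exists_link {M S : ℝ} (hS : |S| ≤ M) {q p : F} (hq : IsStarProjection q)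
    (hp : IsMinimalProjection p) (hqp : q * p = 0) (hpq : p * q = 0)
    (h : S = 0 ∨ IsMinimalProjection q ∧ Linked q p) :
    ∃ w : F, star w * w - w * star w = S • (q - p) ∧ w * w = 0 ∧
      star w * w ≤ M • (q + p) ∧ (q + p) * w = w ∧ w * (q + p) = w := by
  have hM : 0 ≤ M := (abs_nonneg _).trans hS
  have hsqrt : ∀ s : ℝ, 0 ≤ s → ∀ v : F, star (√s • v) * (√s • v) = s • (star v * v) ∧
      (√s • v) * star (√s • v) = s • (v * star v) := fun s hs v => by
    constructor <;> rw [star_smul, smul_mul_smul_comm, star_trivial, Real.mul_self_sqrt hs]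
  have hbound : ∀ (s : ℝ) (e f : F), s ≤ M → IsStarProjection e → IsStarProjection f →
      s • e ≤ M • (e + f) := fun s e f hs he hf => by
    calc s • e ≤ M • e := smul_le_smul_of_nonneg_right hs he.nonneg
      _ ≤ M • (e + f) := smul_le_smul_of_nonneg_left (le_add_of_nonneg_right hf.nonneg) hM
  rcases h with rfl | ⟨hqm, hlink⟩
  · refine ⟨0, by simp, by simp, ?_, by simp, by simp⟩
    simpa using smul_nonneg hM (add_nonneg hq.nonneg hp.isStarProjection.nonneg)
  rcases le_total 0 S with hS0 | hS0
  · obtain ⟨v, h1, h2, h3, h4⟩ :=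
      (hlink.symm hq hp.isStarProjection).exists_partialIsometry hp hqm
    have h5 : q * v = 0 := by rw [← h1, ← mul_assoc, hqp, zero_mul]
    have h6 : v * p = 0 := by rw [← h2, mul_assoc, hqp, mul_zero]
    refine ⟨√S • v, ?_, ?_, ?_, ?_, ?_⟩
    · rw [(hsqrt S hS0 v).1, (hsqrt S hS0 v).2, h3, h4, smul_sub]
    · have hvv : v * v = 0 := by
        calc v * v = v * q * v := by rw [h2]
          _ = 0 := by rw [mul_assoc, h5, mul_zero]
      rw [smul_mul_smul_comm, hvv, smul_zero]
    · rw [(hsqrt S hS0 v).1, h3]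
      exact hbound S q p ((le_abs_self S).trans hS) hq hp.isStarProjection
    · rw [mul_smul_comm, add_mul, h5, h1, zero_add]
    · rw [smul_mul_assoc, mul_add, h6, h2, add_zero]
  · obtain ⟨v, h1, h2, h3, h4⟩ := hlink.exists_partialIsometry hqm hp
    have h5 : p * v = 0 := by rw [← h1, ← mul_assoc, hpq, zero_mul]
    have h6 : v * q = 0 := by rw [← h2, mul_assoc, hpq, mul_zero]
    have hS1 : 0 ≤ -S := neg_nonneg.mpr hS0
    refine ⟨√(-S) • v, ?_, ?_, ?_, ?_, ?_⟩
    · rw [(hsqrt _ hS1 v).1, (hsqrt _ hS1 v).2, h3, h4]; module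
    · have hvv : v * v = 0 := by
        calc v * v = v * p * v := by rw [h2]
          _ = 0 := by rw [mul_assoc, h5, mul_zero]
      rw [smul_mul_smul_comm, hvv, smul_zero]
    · rw [(hsqrt _ hS1 v).1, h3, add_comm q]
      exact hbound _ p q ((neg_le_abs S).trans hS) hp.isStarProjection hq
    · rw [mul_smul_comm, add_mul, h5, h1, add_zero]
    · rw [smul_mul_assoc, mul_add, h6, h2, zero_add]

open Classical in
/-- The telescoping decomposition `S q + ∑ λ_p p = S (q - p₁) + (S + λ_{p₁}) (p₁ - p₂) + ⋯`, whose
alternate terms are collected into the self-commutators of two square-zero elements `x` and `y`.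
The element `x` contains the term at `q`, and `y` is supported on `C`. -/
lemma exists_chain {M : ℝ} (hM : 0 ≤ M) (l : F → ℝ) (C : Finset F)
    (hmin : ∀ p ∈ C, IsMinimalProjection p) (horth : ∀ p ∈ C, ∀ p' ∈ C, p ≠ p' → p * p' = 0)
    (hl : ∀ p ∈ C, |l p| ≤ M) (q : F) (S : ℝ) (hq : q = 0 ∨ IsMinimalProjection q)
    (hqC : ∀ p ∈ C, q * p = 0 ∧ p * q = 0) (hS : |S| ≤ M)
    (hsum : S + ∑ p ∈ C with Linked q p, l p = 0)
    (hsums : ∀ p ∈ C, ¬ Linked q p → ∑ p' ∈ C with Linked p p', l p' = 0) :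
    ∃ x y : F, x * x = 0 ∧ y * y = 0 ∧
      (star x * x - x * star x) + (star y * y - y * star y) = S • q + ∑ p ∈ C, l p • p ∧
      (∀ o, o * q = 0 → q * o = 0 → (∀ p ∈ C, o * p = 0 ∧ p * o = 0) → o * x = 0 ∧ x * o = 0) ∧
      (∀ o, (∀ p ∈ C, o * p = 0 ∧ p * o = 0) → o * y = 0 ∧ y * o = 0) ∧
      star x * x ≤ M • (q + ∑ p ∈ C, p) ∧ star y * y ≤ M • ∑ p ∈ C, p ∧
      Commute (star x * x - x * star x) (star y * y - y * star y) ∧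
      Commute (star x * x - x * star x) q := by
  induction hn : C.card generalizing C q S with
  | zero =>
    obtain rfl := Finset.card_eq_zero.mp hn
    have hS0 : S = 0 := by simpa using hsum
    have hq0 : 0 ≤ q := by
      rcases hq with rfl | h
      · exact le_rfl
      · exact h.isStarProjection.nonneg
    exact ⟨0, 0, by simp, by simp, by simp [hS0], by simp, by simp,
      by simpa using smul_nonneg hM hq0, by simp, by simp, by simp⟩
  | succ n ih =>
    have hqp : IsStarProjection q := by
      rcases hq with rfl | h
      · exact .zero F
      · exact h.isStarProjection
    obtain ⟨j, hj, hlink, hSj, hsum', hsums'⟩ :=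
      exists_next (Finset.card_pos.mp (by omega)) hmin hl hq hS hsum hsums
    have hjm := hmin j hj
    have hsub : ∀ p ∈ C.erase j, p ∈ C := fun p hp => Finset.mem_of_mem_erase hp
    have hjC : ∀ p ∈ C.erase j, j * p = 0 ∧ p * j = 0 := fun p hp =>
      ⟨horth j hj p (hsub p hp) (Finset.ne_of_mem_erase hp).symm,
        horth p (hsub p hp) j hj (Finset.ne_of_mem_erase hp)⟩
    obtain ⟨x', y', hx2, hy2, hxy, hxo, hyo, hxM, hyM, hcom, hcomj⟩ :=
      ih (C.erase j) (fun p hp => hmin p (hsub p hp))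
        (fun p hp p' hp' => horth p (hsub p hp) p' (hsub p' hp'))
        (fun p hp => hl p (hsub p hp)) j (S + l j) (Or.inr hjm) hjC hSj hsum' hsums'
        (by rw [Finset.card_erase_of_mem hj, hn]; rfl)
    obtain ⟨w, hw, hw2, hwM, hw3, hw4⟩ := exists_link hS hqp hjm (hqC j hj).1 (hqC j hj).2 hlink
    -- `y'` and `w` have orthogonal supports.
    obtain ⟨hjy, hyj⟩ := hyo j hjC
    obtain ⟨hqy, hyq⟩ := hyo q fun p hp => hqC p (hsub p hp)
    obtain ⟨hqx, hxq⟩ := hxo q (hqC j hj).1 (hqC j hj).2 fun p hp => hqC p (hsub p hp)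
    have hqs : star q = q := hqp.isSelfAdjoint
    have hjs : star j = j := hjm.star_eq
    have hstar : ∀ {o z : F}, star o = o → o * z = 0 → star z * o = 0 := fun {o z} ho h => by
      rw [← ho, ← star_mul, h, star_zero]
    have hstar' : ∀ {o z : F}, star o = o → z * o = 0 → o * star z = 0 := fun {o z} ho h => by
      rw [← ho, ← star_mul, h, star_zero]
    have hyw : y' * w = 0 := by rw [← hw3, ← mul_assoc, mul_add, hyq, hyj]; simp
    have hwy : w * y' = 0 := by rw [← hw4, mul_assoc, add_mul, hqy, hjy]; simp
    have hysw : star y' * w = 0 := by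
      rw [← hw3, ← mul_assoc, mul_add, hstar hqs hqy, hstar hjs hjy]; simp
    have hwys : w * star y' = 0 := by
      rw [← hw4, mul_assoc, add_mul, hstar' hqs hyq, hstar' hjs hyj]; simp
    have hwsy : star w * y' = 0 := by rw [← star_star (star w * y'), star_mul, star_star, hysw,
      star_zero]
    have hyws : y' * star w = 0 := by rw [← star_star (y' * star w), star_mul, star_star, hwys,
      star_zero]
    have hx1 : star (y' + w) * (y' + w) = star y' * y' + star w * w := by
      rw [star_add, add_mul, mul_add, mul_add, hysw, hwsy]; simp
    have hx1' : (y' + w) * star (y' + w) = y' * star y' + w * star w := by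
      rw [star_add, add_mul, mul_add, mul_add, hwys, hyws]; simp
    have hcx : star (y' + w) * (y' + w) - (y' + w) * star (y' + w)
        = (star y' * y' - y' * star y') + S • (q - j) := by rw [hx1, hx1', ← hw]; abel
    have hzero : ∀ {o z : F}, star o = o → o * z = 0 → z * o = 0 →
        Commute (star z * z - z * star z) o := fun {o z} ho h1 h2 => by
      rw [Commute, SemiconjBy, sub_mul, mul_sub, mul_assoc, h2, mul_assoc, hstar ho h1,
        ← mul_assoc, hstar' ho h2, ← mul_assoc, h1]
      simp
    have hcq : Commute (star (y' + w) * (y' + w) - (y' + w) * star (y' + w)) q := by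
      rw [hcx]
      refine (hzero hqs hqy hyq).add_left (.smul_left ?_ S)
      refine (Commute.refl q).sub_left ?_
      rw [Commute, SemiconjBy, (hqC j hj).1, (hqC j hj).2]
    have hsplit : ∀ f : F → F, ∑ p ∈ C, f p = f j + ∑ p ∈ C.erase j, f p := fun f =>
      (Finset.add_sum_erase C f hj).symm
    refine ⟨y' + w, x', ?_, hx2, ?_, ?_, ?_, ?_, ?_, ?_, hcq⟩
    · rw [add_mul, mul_add, mul_add, hy2, hyw, hwy, hw2]; simp
    · rw [hcx, hsplit]
      calc _ = S • (q - j) + ((star x' * x' - x' * star x')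
            + (star y' * y' - y' * star y')) := by abel
        _ = _ := by rw [hxy]; module
    · intro o h1 h2 h3
      obtain ⟨a1, a2⟩ := hyo o fun p hp => h3 p (hsub p hp)
      obtain ⟨b1, b2⟩ := h3 j hj
      constructor
      · rw [mul_add, a1, ← hw3, ← mul_assoc, mul_add, h1, b1]; simp
      · rw [add_mul, a2, ← hw4, mul_assoc, add_mul, h2, b2]; simp
    · intro o h3
      exact hxo o (h3 j hj).1 (h3 j hj).2 fun p hp => h3 p (hsub p hp)
    · rw [hx1, hsplit]
      calc _ ≤ M • (∑ p ∈ C.erase j, p) + M • (q + j) := add_le_add hyM hwM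
        _ = _ := by rw [← smul_add]; congr 1; abel
    · rw [hsplit]; exact hxM
    · rw [hcx]
      refine (hcom.symm).add_left (.smul_left ?_ S)
      exact (hzero hqs hqx hxq).symm.sub_left hcomj.symm

end Chain

/-! ### Lifting square-zero elements through order zero maps -/

section Lift

variable {F A : Type*} [CStarAlgebra F] [PartialOrder F] [StarOrderedRing F]
  [NonUnitalCStarAlgebra A] [PartialOrder A] [StarOrderedRing A]

/-- An approximate inverse square root `g` of a positive element `c`, that is, `g² c` is
a contraction acting on `c` approximately as a unit. -/
lemma exists_approx_inv_sqrt {c : A} (hc : 0 ≤ c) {δ : ℝ} (hδ : 0 < δ) :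
    ∃ g : A, star g = g ∧ (∀ z, Commute c z → Commute g z) ∧ ‖g * g * c‖ ≤ 1 ∧
      ‖c - g * g * c * c - (g * g * c * c - g * g * c * (g * g * c) * c)‖ ≤ δ := by
  have hsa : IsSelfAdjoint c := hc.isSelfAdjoint
  have hm : ∀ t : ℝ, 0 < max t δ := fun t => lt_max_of_lt_right hδ
  let f : ℝ → ℝ := fun t => √t / max t δ
  have hf : Continuous f := by
    refine Real.continuous_sqrt.div (by fun_prop) fun t => (hm t).ne'
  have hf0 : f 0 = 0 := by simp [f]
  let r : ℝ → ℝ := fun t => f t * f t * t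
  have hr : Continuous r := by fun_prop
  have hr0 : r 0 = 0 := by simp [r]
  have hnonneg : ∀ t ∈ quasispectrum ℝ c, 0 ≤ t := fun t ht =>
    quasispectrum_nonneg_of_nonneg c hc t ht
  have hrt : ∀ t, 0 ≤ t → r t = (t / max t δ) ^ 2 := fun t ht => by
    have : √t * √t = t := Real.mul_self_sqrt ht
    calc r t = (√t * √t) * t / (max t δ) ^ 2 := by simp only [r, f]; ring
      _ = _ := by rw [this]; ring
  have hr01 : ∀ t, 0 ≤ t → 0 ≤ r t ∧ r t ≤ 1 := fun t ht => by
    rw [hrt t ht]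
    have h1 : t / max t δ ≤ 1 := (div_le_one (hm t)).mpr (le_max_left _ _)
    have h2 : 0 ≤ t / max t δ := div_nonneg ht (hm t).le
    exact ⟨sq_nonneg _, pow_le_one₀ h2 h1⟩
  have hid : cfcₙ (fun t : ℝ => t) c = c := cfcₙ_id' ℝ c
  have hgg : cfcₙ f c * cfcₙ f c * c = cfcₙ r c := by
    conv_lhs => enter [2]; rw [← hid]
    rw [← cfcₙ_mul f f c hf.continuousOn hf0 hf.continuousOn hf0,
      ← cfcₙ_mul (fun t => f t * f t) (fun t => t) c (hf.mul hf).continuousOn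
        (by simp only [hf0, mul_zero]) continuousOn_id rfl]
  clear_value r f
  refine ⟨cfcₙ f c, cfcₙ_predicate f c, fun z hz => hz.cfcₙ_real f, ?_, ?_⟩
  · rw [hgg]
    refine norm_cfcₙ_le fun t ht => ?_
    obtain ⟨h1, h2⟩ := hr01 t (hnonneg t ht)
    rwa [Real.norm_eq_abs, abs_of_nonneg h1]
  · rw [hgg]
    have h1 : cfcₙ r c * c = cfcₙ (fun t => r t * t) c := by
      rw [cfcₙ_mul r (fun t => t) c, hid]
    have h2 : cfcₙ r c * cfcₙ r c * c = cfcₙ (fun t => r t * r t * t) c := by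
      rw [cfcₙ_mul (fun t => r t * r t) (fun t => t) c, cfcₙ_mul r r c, hid]
    have h3 : c - cfcₙ r c * c - (cfcₙ r c * c - cfcₙ r c * cfcₙ r c * c)
        = cfcₙ (fun t => t - r t * t - (r t * t - r t * r t * t)) c := by
      rw [cfcₙ_sub (fun t => t - r t * t) (fun t => r t * t - r t * r t * t) c,
        cfcₙ_sub (fun t => t) (fun t => r t * t) c,
        cfcₙ_sub (fun t => r t * t) (fun t => r t * r t * t) c, hid, h1, h2]
    rw [h3]
    refine norm_cfcₙ_le fun t ht => ?_
    have ht0 := hnonneg t ht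
    obtain ⟨h4, h5⟩ := hr01 t ht0
    have h6 : t - r t * t - (r t * t - r t * r t * t) = (1 - r t) ^ 2 * t := by ring
    rw [h6, Real.norm_of_nonneg (by positivity)]
    rcases le_total δ t with h7 | h7
    · have : r t = 1 := by
        rw [hrt t ht0, max_eq_left h7, div_self (by linarith), one_pow]
      rw [this]; simp [hδ.le]
    · have : (1 - r t) ^ 2 ≤ 1 := pow_le_one₀ (by linarith) (by linarith)
      nlinarith

variable {φ : F →CP A} [FiniteDimensional ℂ F]

/-- With `g` an approximate inverse square root of `φ 1`, the map `x ↦ g φ(x)` is approximately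
the homomorphism `π` with `φ = φ(1) π`, multiplied by the square root of `φ 1`. -/
lemma IsOrderZero.exists_lift (hφ : IsOrderZero φ) (hφc : IsContractiveCP φ) {δ : ℝ} (hδ : 0 < δ)
    {x y : F} (hx : x * x = 0) (hy : y * y = 0)
    (hxy : Commute (star x * x - x * star x) (star y * y - y * star y)) :
    ∃ X Y : A, X * X = 0 ∧ Y * Y = 0 ∧ ‖X‖ ≤ ‖x‖ ∧ ‖Y‖ ≤ ‖y‖ ∧
      Commute (star X * X - X * star X) (star Y * Y - Y * star Y) ∧
      ‖star X * X - X * star X + (star Y * Y - Y * star Y)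
        - φ (star x * x - x * star x + (star y * y - y * star y))‖ ≤ δ := by
  set z := star x * x - x * star x + (star y * y - y * star y) with hz
  obtain ⟨g, hg, hgc, hr1, hr2⟩ := exists_approx_inv_sqrt φ.map_one_nonneg
    (show 0 < (δ / (‖z‖ + 1)) ^ 2 by positivity)
  have hcφ : ∀ a, Commute (φ 1) (φ a) := hφ.map_one_commute
  have hgφ : ∀ a, Commute g (φ a) := fun a => hgc _ (hcφ a)
  set r := g * g * φ 1 with hr
  have hrφ : ∀ a, Commute r (φ a) := fun a => ((hgφ a).mul_left (hgφ a)).mul_left (hcφ a)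
  have hrs : star r = r := by
    rw [hr, star_mul, star_mul, hg, φ.isSelfAdjoint_map_one.star_eq]
    exact ((hgφ 1).mul_left (hgφ 1)).symm.eq
  have hmul : ∀ a b, (g * φ a) * (g * φ b) = r * φ (a * b) := fun a b => by
    calc (g * φ a) * (g * φ b) = g * (φ a * g) * φ b := by noncomm_ring
      _ = g * g * (φ a * φ b) := by rw [← (hgφ a).eq]; noncomm_ring
      _ = _ := by rw [hφ.map_mul_map, hr]; noncomm_ring
  have hstar : ∀ a, star (g * φ a) = g * φ (star a) := fun a => by
    rw [star_mul, hg, ← map_star, (hgφ _).eq]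
  have hsc : ∀ a, star (g * φ a) * (g * φ a) - (g * φ a) * star (g * φ a)
      = r * φ (star a * a - a * star a) := fun a => by
    rw [hstar, hmul, hmul, map_sub, mul_sub]
  have hnorm : ∀ a, ‖g * φ a‖ ≤ ‖a‖ := fun a => by
    refine le_of_sq_le_sq ?_ (norm_nonneg _)
    rw [sq, ← CStarRing.norm_star_mul_self, hstar, hmul, sq, ← CStarRing.norm_star_mul_self]
    calc ‖r * φ (star a * a)‖ ≤ ‖r‖ * ‖φ (star a * a)‖ := norm_mul_le _ _
      _ ≤ 1 * ‖star a * a‖ := by gcongr; exact hφc _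
      _ = _ := one_mul _
  refine ⟨g * φ x, g * φ y, by rw [hmul, hx]; simp, by rw [hmul, hy]; simp, hnorm x, hnorm y,
    ?_, ?_⟩
  · rw [hsc, hsc]
    have h1 : Commute (φ (star x * x - x * star x)) (φ (star y * y - y * star y)) := by
      rw [Commute, SemiconjBy, hφ.map_mul_map, hxy.eq, ← hφ.map_mul_map]
    exact ((Commute.refl r).mul_right (hrφ _)).mul_left ((hrφ _).symm.mul_right h1)
  · rw [hsc, hsc, ← mul_add, ← map_add, ← hz]
    have h1 : ‖r * φ z - φ z‖ ^ 2 ≤ (δ / (‖z‖ + 1)) ^ 2 * ‖z‖ ^ 2 := by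
      have e1 : star (r * φ z - φ z) * (r * φ z - φ z)
          = (φ 1 - r * φ 1 - (r * φ 1 - r * r * φ 1)) * φ (star z * z) := by
        have h2 : star (r * φ z - φ z) = r * φ (star z) - φ (star z) := by
          rw [star_sub, star_mul, hrs, ← map_star, (hrφ _).eq]
        have h3 := hφ.map_mul_map (star z) z
        have h4 : φ (star z) * r = r * φ (star z) := (hrφ _).eq.symm
        rw [h2]
        calc (r * φ (star z) - φ (star z)) * (r * φ z - φ z)
            = r * (φ (star z) * r) * φ z - r * (φ (star z) * φ z) - φ (star z) * r * φ z
              + φ (star z) * φ z := by noncomm_ring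
          _ = r * r * (φ (star z) * φ z) - r * (φ (star z) * φ z) - r * (φ (star z) * φ z)
              + φ (star z) * φ z := by rw [h4]; noncomm_ring
          _ = _ := by rw [h3]; noncomm_ring
      rw [sq, ← CStarRing.norm_star_mul_self, e1]
      calc _ ≤ ‖φ 1 - r * φ 1 - (r * φ 1 - r * r * φ 1)‖ * ‖φ (star z * z)‖ := norm_mul_le _ _
        _ ≤ (δ / (‖z‖ + 1)) ^ 2 * ‖star z * z‖ := by gcongr; exact hφc _
        _ = _ := by rw [CStarRing.norm_star_mul_self, sq ‖z‖]
    rw [← mul_pow] at h1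
    refine (le_of_sq_le_sq h1 (by positivity)).trans ?_
    rw [div_mul_eq_mul_div, div_le_iff₀ (by positivity)]
    nlinarith [norm_nonneg z]

end Lift

/-! ### One order zero summand -/

section Summand

lemma norm_sum_orthogonal_le {A ι : Type*} [NonUnitalCStarAlgebra A] (s : Finset ι) (f : ι → A) {K : ℝ} (hK : 0 ≤ K)
    (hsa : ∀ i ∈ s, IsSelfAdjoint (f i)) (ho : ∀ i ∈ s, ∀ j ∈ s, i ≠ j → f i * f j = 0)
    (hf : ∀ i ∈ s, ‖f i‖ ≤ K) : ‖∑ i ∈ s, f i‖ ≤ K := by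
  classical
  induction s using Finset.induction_on with
  | empty => simpa
  | insert a s ha ih =>
    rw [Finset.sum_insert ha]
    have h1 : IsSelfAdjoint (∑ i ∈ s, f i) :=
      isSelfAdjoint_sum s fun i hi => hsa i (Finset.mem_insert_of_mem hi)
    rw [(hsa a (Finset.mem_insert_self a s)).norm_add_eq_max h1]
    · refine max_le (hf a (Finset.mem_insert_self a s)) (ih ?_ ?_ ?_)
      · exact fun i hi => hsa i (Finset.mem_insert_of_mem hi)
      · exact fun i hi j hj => ho i (Finset.mem_insert_of_mem hi) j (Finset.mem_insert_of_mem hj)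
      · exact fun i hi => hf i (Finset.mem_insert_of_mem hi)
    · rw [Finset.mul_sum]
      refine Finset.sum_eq_zero fun i hi => ho a (Finset.mem_insert_self a s) i
        (Finset.mem_insert_of_mem hi) ?_
      rintro rfl
      exact ha hi

variable {F A : Type*} [CStarAlgebra F] [PartialOrder F] [StarOrderedRing F]
  [NonUnitalCStarAlgebra A] [PartialOrder A] [StarOrderedRing A]

variable {φ : F →CP A} [FiniteDimensional ℂ F]

lemma IsOrderZero.norm_map_eq_of_linked (hφ : IsOrderZero φ) {p q : F}
    (hp : IsMinimalProjection p) (hq : IsMinimalProjection q) (h : Linked p q) :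
    ‖φ p‖ = ‖φ q‖ := by
  obtain ⟨w, -, -, h3, h4⟩ := h.exists_partialIsometry hp hq
  have hsq : ∀ e : F, IsMinimalProjection e → ‖φ 1 * φ e‖ = ‖φ e‖ * ‖φ e‖ := fun e he => by
    rw [hφ.map_one_mul_map_projection he.isStarProjection, ← CStarRing.norm_star_mul_self,
      ← map_star, he.star_eq]
  have h5 : ‖φ 1 * φ q‖ = ‖φ w‖ * ‖φ w‖ := by
    rw [← h3, ← hφ.map_mul_map, map_star, CStarRing.norm_star_mul_self]
  have h6 : ‖φ 1 * φ p‖ = ‖φ w‖ * ‖φ w‖ := by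
    rw [← h4, ← hφ.map_mul_map, map_star, CStarRing.norm_self_mul_star]
  rw [hsq q hq] at h5
  rw [hsq p hp, ← h5] at h6
  exact (mul_self_inj (norm_nonneg _) (norm_nonneg _)).mp h6

open Classical in
/-- If all blocks on which `φ` is not small give `k` a small normalized trace, then `φ k` is
approximately the sum of two commuting self-commutators of square-zero elements. On these blocks the
eigenvalues of `k` are corrected to have sum zero and rescaled to stay bounded by `M`; on the
remaining blocks they are replaced by zero. -/
lemma IsOrderZero.exists_commutators (hφ : IsOrderZero φ) (hφc : IsContractiveCP φ) {k : F}
    (hk : IsSelfAdjoint k) {M δ η : ℝ} (hkM : ‖k‖ ≤ M) (hδ : 0 < δ) (hη : 0 < η)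
    (H : ∀ C : Finset F, IsBlock C → (∀ p ∈ C, η ≤ ‖φ p‖) → ‖blockTrace C k‖ ≤ C.card * δ) :
    ∃ X Y : A, X * X = 0 ∧ Y * Y = 0 ∧ ‖X‖ ^ 2 ≤ M ∧ ‖Y‖ ^ 2 ≤ M ∧
      Commute (star X * X - X * star X) (star Y * Y - Y * star Y) ∧
      ‖star X * X - X * star X + (star Y * Y - Y * star Y) - φ k‖ ≤ 3 * δ + M * η := by
  have hM : 0 ≤ M := (norm_nonneg _).trans hkM
  obtain ⟨s, l, hs, ho, h1, hl⟩ := exists_diagonalization hk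
  have hlM : ∀ p ∈ s, |l p| ≤ M := fun p hp => by
    have h2 := norm_mul_le k p
    rw [hl p hp, norm_smul, (hs p hp).norm_eq_one, mul_one, mul_one] at h2
    exact h2.trans hkM
  have hcoef : ∀ p ∈ s, cornerCoeff p k = l p := fun p hp => (hs p hp).cornerCoeff_eq <| by
    rw [mul_assoc, hl p hp, mul_smul_comm, (hs p hp).mul_self, Complex.coe_smul]
  let Cl : F → Finset F := fun p => s.filter (Linked p)
  have hmemCl : ∀ p ∈ s, ∀ q ∈ Cl p, q ∈ s ∧ Linked p q := fun p _ q hq => Finset.mem_filter.mp hq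
  have hpCl : ∀ p ∈ s, p ∈ Cl p := fun p hp =>
    Finset.mem_filter.mpr ⟨hp, Linked.refl (hs p hp)⟩
  have hCleq : ∀ p ∈ s, ∀ q ∈ Cl p, Cl q = Cl p := by
    intro p hp q hq
    obtain ⟨hqs, hpq⟩ := hmemCl p hp q hq
    refine Finset.filter_congr fun e he => ⟨hpq.trans (hs p hp) (hs q hqs) (hs e he),
      (hpq.symm (hs p hp).isStarProjection (hs q hqs).isStarProjection).trans
        (hs q hqs) (hs p hp) (hs e he)⟩
  have hnorm : ∀ p ∈ s, ∀ q ∈ Cl p, ‖φ q‖ = ‖φ p‖ := fun p hp q hq =>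
    (hφ.norm_map_eq_of_linked (hs p hp) (hs q (hmemCl p hp q hq).1) (hmemCl p hp q hq).2).symm
  let avg : F → ℝ := fun p => (∑ q ∈ Cl p, l q) / (Cl p).card
  have hcard : ∀ p ∈ s, (0 : ℝ) < (Cl p).card := fun p hp => by
    exact_mod_cast Finset.card_pos.mpr ⟨p, hpCl p hp⟩
  have havg : ∀ p ∈ s, η ≤ ‖φ p‖ → |avg p| ≤ δ := by
    intro p hp hgood
    have h2 := H (Cl p) (isBlock_filter_linked hs ho h1 hp)
      fun q hq => by rw [hnorm p hp q hq]; exact hgood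
    have h3 : blockTrace (Cl p) k = ((∑ q ∈ Cl p, l q : ℝ) : ℂ) := by
      rw [blockTrace, Complex.ofReal_sum]
      exact Finset.sum_congr rfl fun q hq => hcoef q (hmemCl p hp q hq).1
    rw [h3, Complex.norm_real, Real.norm_eq_abs] at h2
    rw [abs_div, abs_of_pos (hcard p hp), div_le_iff₀ (hcard p hp), mul_comm]
    exact h2
  have hMδ : 0 < M + δ := by positivity
  set κ : ℝ := M / (M + δ) with hκ
  have hκ0 : 0 ≤ κ := by positivity
  have hκ1 : κ ≤ 1 := (div_le_one hMδ).mpr (by linarith)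
  have hκM : κ * (M + δ) = M := div_mul_cancel₀ _ hMδ.ne'
  let l' : F → ℝ := fun p => if η ≤ ‖φ p‖ then κ * (l p - avg p) else 0
  have hl'M : ∀ p ∈ s, |l' p| ≤ M := by
    intro p hp
    by_cases hg : η ≤ ‖φ p‖
    · simp only [l', if_pos hg]
      rw [abs_mul, abs_of_nonneg hκ0, ← hκM]
      refine mul_le_mul_of_nonneg_left ((abs_sub _ _).trans ?_) hκ0
      exact add_le_add (hlM p hp) (havg p hp hg)
    · simpa only [l', if_neg hg, abs_zero] using hM
  have hsums : ∀ p ∈ s, ∑ q ∈ s with Linked p q, l' q = 0 := by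
    intro p hp
    change ∑ q ∈ Cl p, l' q = 0
    by_cases hg : η ≤ ‖φ p‖
    · have h2 : ∀ q ∈ Cl p, l' q = κ * (l q - avg p) := fun q hq => by
        have h3 : avg q = avg p := by simp only [avg, hCleq p hp q hq]
        simp only [l', hnorm p hp q hq, if_pos hg, h3]
      rw [Finset.sum_congr rfl h2, ← Finset.mul_sum, Finset.sum_sub_distrib, Finset.sum_const,
        nsmul_eq_mul, mul_div_cancel₀ _ (hcard p hp).ne', sub_self, mul_zero]
    · exact Finset.sum_eq_zero fun q hq => by simp only [l', hnorm p hp q hq, if_neg hg]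
  have hnot : ∀ p : F, ¬ Linked 0 p := by rintro p ⟨u, hu⟩; simp at hu
  obtain ⟨x, y, hx, hy, hxy, -, -, hxM, hyM, hcom, -⟩ := exists_chain hM l' s hs ho hl'M 0 0
    (Or.inl rfl) (by simp) (by simpa) (by simp [hnot]) (fun p hp _ => hsums p hp)
  rw [zero_add, h1] at hxM
  rw [h1] at hyM
  have hone : ‖(M : ℝ) • (1 : F)‖ ≤ M := by
    rw [norm_smul, Real.norm_of_nonneg hM]
    exact mul_le_of_le_one_right hM (IsStarProjection.norm_le _ (.one F))
  have hsqM : ∀ v : F, star v * v ≤ M • 1 → ‖v‖ ^ 2 ≤ M := fun v hv => by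
    rw [sq, ← CStarRing.norm_star_mul_self]
    exact (CStarAlgebra.norm_le_norm_of_nonneg_of_le (star_mul_self_nonneg v) hv).trans hone
  obtain ⟨X, Y, hX, hY, hXx, hYy, hXY, happ⟩ := hφ.exists_lift hφc hδ hx hy hcom
  refine ⟨X, Y, hX, hY, (pow_le_pow_left₀ (norm_nonneg _) hXx 2).trans (hsqM x hxM),
    (pow_le_pow_left₀ (norm_nonneg _) hYy 2).trans (hsqM y hyM), hXY, ?_⟩
  rw [smul_zero, zero_add] at hxy
  rw [hxy] at happ
  have hk' : k = ∑ p ∈ s, l p • p := by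
    rw [← mul_one k, ← h1, Finset.mul_sum]
    exact Finset.sum_congr rfl hl
  have hdiff : φ (∑ p ∈ s, l' p • p) - φ k = ∑ p ∈ s, (l' p - l p) • φ p := by
    rw [← map_sub, hk', ← Finset.sum_sub_distrib, map_sum]
    refine Finset.sum_congr rfl fun p _ => ?_
    rw [← sub_smul, ← Complex.coe_smul, map_smul, Complex.coe_smul]
  have hbound : ‖φ (∑ p ∈ s, l' p • p) - φ k‖ ≤ 2 * δ + M * η := by
    rw [hdiff]
    refine norm_sum_orthogonal_le s _ (by positivity) ?_ ?_ ?_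
    · intro p hp
      refine IsSelfAdjoint.smul (.all _) ?_
      rw [isSelfAdjoint_iff, ← map_star, (hs p hp).star_eq]
    · intro p hp q hq hne
      rw [smul_mul_smul_comm, hφ p q (hs p hp).isStarProjection.nonneg
        (hs q hq).isStarProjection.nonneg (ho p hp q hq hne), smul_zero]
    · intro p hp
      have hφp : ‖φ p‖ ≤ 1 := (hφc p).trans (hs p hp).norm_eq_one.le
      rw [norm_smul, Real.norm_eq_abs]
      by_cases hg : η ≤ ‖φ p‖
      · simp only [l', if_pos hg]
        have h2 := hlM p hp
        have h3 := havg p hp hg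
        have h4 : |κ * (l p - avg p) - l p| ≤ 2 * δ := by
          have e : κ * (l p - avg p) - l p = -((1 - κ) * l p) - κ * avg p := by ring
          rw [e]
          refine (abs_sub _ _).trans ?_
          rw [abs_neg, abs_mul, abs_mul, abs_of_nonneg hκ0, abs_of_nonneg (sub_nonneg.mpr hκ1)]
          have h5 : (1 - κ) * |l p| ≤ (1 - κ) * M :=
            mul_le_mul_of_nonneg_left h2 (sub_nonneg.mpr hκ1)
          have h6 : κ * |avg p| ≤ κ * δ := mul_le_mul_of_nonneg_left h3 hκ0
          nlinarith
        calc _ ≤ 2 * δ * 1 := mul_le_mul h4 hφp (norm_nonneg _) (by positivity)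
          _ ≤ _ := by nlinarith
      · simp only [l', if_neg hg, zero_sub, abs_neg]
        push Not at hg
        calc _ ≤ M * η := mul_le_mul (hlM p hp) hg.le (norm_nonneg _) hM
          _ ≤ _ := by linarith
  calc _ ≤ ‖star X * X - X * star X + (star Y * Y - Y * star Y) - φ (∑ p ∈ s, l' p • p)‖
        + ‖φ (∑ p ∈ s, l' p • p) - φ k‖ := norm_sub_le_norm_sub_add_norm_sub _ _ _
    _ ≤ δ + (2 * δ + M * η) := add_le_add happ hbound
    _ = _ := by ring

end Summand

/-! ### Traces of images of commutators -/

section BlockTrace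

variable {F A : Type*} [CStarAlgebra F] [PartialOrder F] [StarOrderedRing F]
  [NonUnitalCStarAlgebra A] [PartialOrder A] [StarOrderedRing A]

lemma norm_one_sub_le_one {d : F} (hd : 0 ≤ d) (hd1 : ‖d‖ ≤ 1) : ‖1 - d‖ ≤ 1 := by
  have h1 : d ≤ 1 := (CStarAlgebra.norm_le_one_iff_of_nonneg d hd).mp hd1
  rw [CStarAlgebra.norm_le_one_iff_of_nonneg _ (sub_nonneg.mpr h1)]
  exact sub_le_self 1 hd

lemma norm_one_sub_pow_mul_le {d : F} (hd : 0 ≤ d) (hd1 : ‖d‖ ≤ 1) {n : ℕ} (hn : 0 < n) :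
    ‖(1 - d) ^ n * d * (1 - d) ^ n‖ ≤ 1 / n := by
  have hsa : IsSelfAdjoint d := hd.isSelfAdjoint
  have h1 : d ≤ 1 := (CStarAlgebra.norm_le_one_iff_of_nonneg d hd).mp hd1
  have h2 : (1 - d) ^ n * d * (1 - d) ^ n = cfc (fun t : ℝ => (1 - t) ^ n * t * (1 - t) ^ n) d := by
    have h3 : cfc (fun t : ℝ => (1 - t) ^ n) d = (1 - d) ^ n := by
      rw [cfc_pow (fun t : ℝ => 1 - t) n d, cfc_sub (fun _ : ℝ => 1) (fun t => t) d,
        cfc_const_one ℝ d, cfc_id' ℝ d]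
    rw [cfc_mul (fun t : ℝ => (1 - t) ^ n * t) (fun t => (1 - t) ^ n) d,
      cfc_mul (fun t : ℝ => (1 - t) ^ n) (fun t => t) d, h3, cfc_id' ℝ d]
  rw [h2]
  refine norm_cfc_le (by positivity) fun t ht => ?_
  have ht0 : 0 ≤ t := spectrum_nonneg_of_nonneg hd ht
  have ht1 : t ≤ 1 := by
    have := (spectrum.norm_le_norm_mul_of_mem ht).trans
      (mul_le_one₀ hd1 (norm_nonneg _) (IsStarProjection.norm_le (1 : F) (.one F)))
    exact (le_abs_self t).trans this
  have hs : 0 ≤ 1 - t := sub_nonneg.mpr ht1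
  have h3 : (1 - t) ^ n ≤ 1 := pow_le_one₀ hs (by linarith)
  have h4 : (1 - t) ^ n * (n * t) ≤ 1 := by
    have h5 : 1 + n * t ≤ (1 + t) ^ n := one_add_mul_le_pow (by linarith) n
    calc (1 - t) ^ n * (n * t) ≤ (1 - t) ^ n * (1 + t) ^ n := by gcongr; linarith
      _ = (1 - t ^ 2) ^ n := by rw [← mul_pow]; ring_nf
      _ ≤ 1 := pow_le_one₀ (by nlinarith) (by nlinarith)
  rw [Real.norm_of_nonneg (by positivity), le_div_iff₀ (by exact_mod_cast hn)]
  calc (1 - t) ^ n * t * (1 - t) ^ n * n = ((1 - t) ^ n * (n * t)) * (1 - t) ^ n := by ring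
    _ ≤ 1 * 1 := by gcongr
    _ = 1 := one_mul 1

/-- If `d = ψ(e²)` then `(1 - d)ⁿ` nearly annihilates `ψ(e² y)`. -/
lemma norm_one_sub_pow_mul_map_le {ψ : A →CP F} (hψ : IsContractiveCP ψ) {e : A}
    (he : star e = e) (he1 : ‖e‖ ≤ 1) (y : A) {n : ℕ} (hn : 0 < n) :
    ‖(1 - ψ (e * e)) ^ n * ψ (e * (e * y))‖ ^ 2 ≤ 1 / n * ‖y‖ ^ 2 := by
  have hd : 0 ≤ ψ (e * e) := by
    have := map_nonneg ψ (star_mul_self_nonneg e)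
    rwa [he] at this
  have hd1 : ‖ψ (e * e)‖ ≤ 1 :=
    (hψ _).trans ((norm_mul_le _ _).trans (mul_le_one₀ he1 (norm_nonneg _) he1))
  set U := (1 - ψ (e * e)) ^ n with hU
  have hUs : star U = U := by rw [hU, star_pow, star_sub, star_one, hd.isSelfAdjoint.star_eq]
  have h := CStarAlgebra.norm_sq_le_of_form_nonneg (P := U * ψ (e * e) * U)
    (Y := U * ψ (e * (e * y))) (Q := ψ (star (e * y) * (e * y)))
    (by rw [isSelfAdjoint_iff, ← map_star, star_mul, star_star]) ?_
  · have hey : ‖e * y‖ ≤ ‖y‖ := (norm_mul_le _ _).trans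
      (mul_le_of_le_one_left (norm_nonneg _) he1)
    have hQ : ‖ψ (star (e * y) * (e * y))‖ ≤ ‖y‖ ^ 2 := by
      refine (hψ _).trans ?_
      rw [CStarRing.norm_star_mul_self, sq]
      gcongr
    exact h.trans (mul_le_mul (norm_one_sub_pow_mul_le hd hd1 hn) hQ (norm_nonneg _)
      (by positivity))
  · intro g g'
    convert ψ.two_nonneg e (e * y) (U * g) g' using 1
    simp only [star_mul, he, hUs, ← map_star, mul_assoc]

variable {φ : F →CP A} [FiniteDimensional ℂ F]

/-- The normalized trace of `ψ [a, b]` is small on every block on which `φ` is not small, provided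
that `T = φ ∘ ψ` satisfies `T(a) T(b) ≈ T(e²) T(a b)` and similar relations. Since
`ψ [a, b] = (1 - d)ⁿ ψ [a, b] + ∑_{k < n} (1 - d)ᵏ d ψ [a, b]` with `d = ψ(e²)`, and on such a
block `d ψ(a b) ≈ ψ(a) ψ(b)` and `d` almost commutes with `ψ(a)`, this follows from the trace
property. -/
lemma norm_blockTrace_commutator_le {ψ : A →CP F} (hψ : IsContractiveCP ψ) (hφ : IsOrderZero φ)
    {e a b : A} (he : star e = e) (he1 : ‖e‖ ≤ 1) {δ η : ℝ} (hη : 0 < η)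
    (hab : ‖φ (ψ a) * φ (ψ b) - φ (ψ (e * e)) * φ (ψ (a * b))‖ ≤ δ)
    (hba : ‖φ (ψ b) * φ (ψ a) - φ (ψ (e * e)) * φ (ψ (b * a))‖ ≤ δ)
    (ha : ‖φ (ψ (e * e)) * φ (ψ a) - φ (ψ a) * φ (ψ (e * e))‖ ≤ δ)
    (hy : ‖a * b - b * a - e * (e * (a * b - b * a))‖ ≤ δ) {n : ℕ} (hn : 0 < n)
    {C : Finset F} (hC : IsBlock C) (hgood : ∀ p ∈ C, η ≤ ‖φ p‖) :
    ‖blockTrace C (ψ (a * b - b * a))‖ ≤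
      C.card * (√(1 / n * ‖a * b - b * a‖ ^ 2) + δ + n * (δ / η ^ 2 * (2 + n * ‖b‖))) := by
  have hδ : 0 ≤ δ := (norm_nonneg _).trans hab
  set y := a * b - b * a with hydef
  set v := δ / η ^ 2 with hv
  have hv0 : 0 ≤ v := by positivity
  set d := ψ (e * e) with hd
  have hd0 : 0 ≤ d := by
    have := map_nonneg ψ (star_mul_self_nonneg e)
    rwa [he] at this
  have hd1 : ‖d‖ ≤ 1 :=
    (hψ _).trans ((norm_mul_le _ _).trans (mul_le_one₀ he1 (norm_nonneg _) he1))
  set u := 1 - d with hu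
  have hu1 : ‖u‖ ≤ 1 := norm_one_sub_le_one hd0 hd1
  have hone : ‖(1 : F)‖ ≤ 1 := IsStarProjection.norm_le _ (.one F)
  have hupow : ∀ k, ‖u ^ k‖ ≤ 1 := fun k => by
    induction k with
    | zero => simpa using hone
    | succ k ih =>
      rw [pow_succ]
      exact (norm_mul_le _ _).trans (mul_le_one₀ ih (norm_nonneg _) hu1)
  have hmulc : ∀ x z : F, φ (x * z) * φ 1 = φ x * φ z := fun x z => by
    rw [hφ.map_mul_map x z, hφ.map_one_commute]
  -- Elements `x` with `φ(x) φ(1) ≈ 0` are negligible on the block.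
  have hsmall : ∀ x : F, ‖φ x * φ 1‖ ≤ δ → ∀ (w : F) (W : ℝ), ‖w‖ ≤ W →
      ‖blockTrace C (w * x)‖ ≤ C.card * (W * v) := by
    intro x hx w W hw
    refine hC.norm_blockTrace_le fun p hp => ?_
    have h1 := (hφ.norm_mul_minimal_le (hC.minimal p hp) x).trans hx
    have h2 : ‖x * p‖ ≤ v := by
      rw [hv, le_div_iff₀ (by positivity), mul_comm]
      refine le_trans ?_ h1
      gcongr
      exact hgood p hp
    rw [mul_assoc]
    exact (norm_mul_le _ _).trans (mul_le_mul hw h2 (norm_nonneg _) ((norm_nonneg w).trans hw))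
  have hR : ∀ a b : A, ‖φ (ψ a) * φ (ψ b) - φ d * φ (ψ (a * b))‖ ≤ δ →
      ‖φ (ψ a * ψ b - d * ψ (a * b)) * φ 1‖ ≤ δ := fun a b h => by
    rwa [map_sub, sub_mul, hmulc, hmulc]
  have hG : ‖φ (d * ψ a - ψ a * d) * φ 1‖ ≤ δ := by
    rwa [map_sub, sub_mul, hmulc, hmulc]
  have hcomm : ∀ (k : ℕ) (w : F), ‖w‖ ≤ 1 →
      ‖blockTrace C (w * (u ^ k * ψ a - ψ a * u ^ k) * ψ b)‖ ≤ C.card * (k * (‖b‖ * v)) := by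
    intro k
    induction k with
    | zero => intro w _; simp [hC.blockTrace_zero]
    | succ k ih =>
      intro w hw
      have e1 : w * (u ^ (k + 1) * ψ a - ψ a * u ^ (k + 1)) * ψ b
          = w * u * (u ^ k * ψ a - ψ a * u ^ k) * ψ b
            - w * (d * ψ a - ψ a * d) * (u ^ k * ψ b) := by
        have e2 : d * ψ a - ψ a * d = -(u * ψ a - ψ a * u) := by rw [hu]; noncomm_ring
        rw [e2, pow_succ']
        noncomm_ring
      have e3 : blockTrace C (w * (d * ψ a - ψ a * d) * (u ^ k * ψ b))
          = blockTrace C (u ^ k * ψ b * w * (d * ψ a - ψ a * d)) := by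
        rw [hC.blockTrace_mul_comm, mul_assoc _ w]
      have h1 := ih (w * u) ((norm_mul_le _ _).trans (mul_le_one₀ hw (norm_nonneg _) hu1))
      have h2 := hsmall _ hG (u ^ k * ψ b * w) ‖b‖ <| by
        calc ‖u ^ k * ψ b * w‖ ≤ ‖u ^ k‖ * ‖ψ b‖ * ‖w‖ :=
              (norm_mul_le _ _).trans (by gcongr; exact norm_mul_le _ _)
          _ ≤ 1 * ‖b‖ * 1 := by gcongr; exacts [hupow k, hψ b]
          _ = ‖b‖ := by ring
      rw [e1, hC.blockTrace_sub, e3]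
      calc _ ≤ _ := norm_sub_le _ _
        _ ≤ _ := add_le_add h1 h2
        _ = _ := by push_cast; ring
  have hstep : ∀ k < n, ‖blockTrace C (u ^ k * d * ψ y)‖ ≤ C.card * (v * (2 + n * ‖b‖)) := by
    intro k hk
    have e1 : u ^ k * d * ψ y = (u ^ k * ψ a * ψ b - u ^ k * ψ b * ψ a)
        - u ^ k * (ψ a * ψ b - d * ψ (a * b)) + u ^ k * (ψ b * ψ a - d * ψ (b * a)) := by
      rw [hydef, map_sub]; noncomm_ring
    have e2 : blockTrace C (u ^ k * ψ a * ψ b - u ^ k * ψ b * ψ a)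
        = blockTrace C (1 * (u ^ k * ψ a - ψ a * u ^ k) * ψ b) := by
      rw [hC.blockTrace_sub, hC.blockTrace_mul_comm (u ^ k * ψ b), ← hC.blockTrace_sub]
      congr 1
      noncomm_ring
    rw [e1, hC.blockTrace_add, hC.blockTrace_sub, e2]
    have h1 := hcomm k 1 hone
    have h2 := hsmall _ (hR a b hab) (u ^ k) 1 (hupow k)
    have h3 := hsmall _ (hR b a hba) (u ^ k) 1 (hupow k)
    have hkn : (k : ℝ) ≤ n := by exact_mod_cast hk.le
    calc _ ≤ _ := (norm_add_le _ _).trans (add_le_add (norm_sub_le _ _) le_rfl)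
      _ ≤ C.card * (k * (‖b‖ * v)) + C.card * (1 * v) + C.card * (1 * v) := by gcongr
      _ ≤ C.card * (n * (‖b‖ * v)) + C.card * (1 * v) + C.card * (1 * v) := by gcongr
      _ = _ := by ring
  have hgeom : ψ y = u ^ n * ψ y + ∑ k ∈ Finset.range n, u ^ k * d * ψ y := by
    have h1 : (∑ k ∈ Finset.range n, u ^ k) * d = 1 - u ^ n := by
      rw [show d = 1 - u by rw [hu]; abel]
      exact geom_sum_mul_neg u n
    rw [← Finset.sum_mul, ← Finset.sum_mul, h1, sub_mul, one_mul, add_sub_cancel]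
  have hfirst : ‖u ^ n * ψ y‖ ≤ √(1 / n * ‖y‖ ^ 2) + δ := by
    have e1 : u ^ n * ψ y = u ^ n * ψ (e * (e * y)) + u ^ n * ψ (y - e * (e * y)) := by
      rw [← mul_add, ← map_add]; congr 2; abel
    rw [e1]
    refine (norm_add_le _ _).trans (add_le_add ?_ ?_)
    · exact Real.le_sqrt_of_sq_le (norm_one_sub_pow_mul_map_le hψ he he1 y hn)
    · calc _ ≤ ‖u ^ n‖ * ‖ψ (y - e * (e * y))‖ := norm_mul_le _ _
        _ ≤ 1 * δ := mul_le_mul (hupow n) ((hψ _).trans hy) (norm_nonneg _) zero_le_one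
        _ = δ := one_mul δ
  rw [hgeom, hC.blockTrace_add, hC.blockTrace_sum]
  calc _ ≤ _ := norm_add_le _ _
    _ ≤ C.card * (√(1 / n * ‖y‖ ^ 2) + δ) + ∑ k ∈ Finset.range n, C.card * (v * (2 + n * ‖b‖)) :=
        add_le_add ((hC.norm_blockTrace_le_norm _).trans
            (mul_le_mul_of_nonneg_left hfirst (Nat.cast_nonneg _)))
          (norm_sum_le_of_le _ fun k hk => hstep k (Finset.mem_range.mp hk))
    _ = _ := by rw [Finset.sum_const, Finset.card_range, nsmul_eq_mul]; ring

end BlockTrace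

/-! ### Asymptotics of decomposable approximations -/

section Approximations

open Filter Topology

/-- The composition of completely positive maps. -/
noncomputable def CompletelyPositiveMap.comp {A B C : Type*}
    [NonUnitalCStarAlgebra A] [PartialOrder A] [StarOrderedRing A]
    [NonUnitalCStarAlgebra B] [PartialOrder B] [StarOrderedRing B]
    [NonUnitalCStarAlgebra C] [PartialOrder C] [StarOrderedRing C]
    (φ : B →CP C) (ψ : A →CP B) : A →CP C where
  toLinearMap := φ.toLinearMap.comp ψ.toLinearMap
  map_cstarMatrix_nonneg' k M hM :=
    φ.map_cstarMatrix_nonneg' k _ (ψ.map_cstarMatrix_nonneg' k M hM)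

variable (A : Type*) [NonUnitalCStarAlgebra A] [PartialOrder A] [StarOrderedRing A]

/-- The data `A → F 0 ⊕ F 1 → A` of a completely positive approximation with two order zero summands,
with no condition relating the composition to the identity of `A`. -/
structure DecomposableApproximation where
  F : Fin 2 → Type
  cstar : ∀ i, CStarAlgebra (F i)
  order : ∀ i, PartialOrder (F i)
  starOrdered : ∀ i, StarOrderedRing (F i)
  finite : ∀ i, FiniteDimensional ℂ (F i)
  ψ : ∀ i, A →CP F i
  φ : ∀ i, F i →CP A
  contractive_ψ : ∀ i, IsContractiveCP (ψ i)
  contractive_φ : ∀ i, IsContractiveCP (φ i)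
  orderZero : ∀ i, IsOrderZero (φ i)

attribute [instance] DecomposableApproximation.cstar DecomposableApproximation.order
  DecomposableApproximation.starOrdered DecomposableApproximation.finite

variable {A}

namespace DecomposableApproximation

/-- The composition of the approximation through the `i`-th summand. -/
noncomputable def T (D : DecomposableApproximation A) (i : Fin 2) : A →CP A := (D.φ i).comp (D.ψ i)

lemma norm_T_le (D : DecomposableApproximation A) (i : Fin 2) (a : A) : ‖D.T i a‖ ≤ ‖a‖ :=
  (D.contractive_φ i _).trans (D.contractive_ψ i a)

variable (A) in
/-- The filter along which the approximations converge to the identity pointwise in norm. -/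
noncomputable def convergence : Filter (DecomposableApproximation A) :=
  ⨅ a : A, comap (fun D => D.T 0 a + D.T 1 a) (𝓝 a)

lemma tendsto_convergence (a : A) :
    Tendsto (fun D : DecomposableApproximation A => D.T 0 a + D.T 1 a) (convergence A) (𝓝 a) :=
  tendsto_iff_comap.mpr (iInf_le _ a)

lemma convergence_neBot (hA : NuclearDimensionAtMost A 1) : (convergence A).NeBot := by
  rw [convergence, neBot_iff]
  intro hbot
  have hmem : (∅ : Set (DecomposableApproximation A)) ∈
      ⨅ a : A, comap (fun D : DecomposableApproximation A => D.T 0 a + D.T 1 a) (𝓝 a) := by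
    rw [hbot]; exact mem_bot
  rw [mem_iInf] at hmem
  obtain ⟨I, hI, V, hV, hempty⟩ := hmem
  have hball : ∀ a : I, ∃ ε > 0, ∀ D : DecomposableApproximation A,
      ‖D.T 0 a + D.T 1 a - a‖ < ε → D ∈ V a := by
    intro a
    obtain ⟨U, hU, hUV⟩ := mem_comap.mp (hV a)
    obtain ⟨ε, hε, hεU⟩ := Metric.mem_nhds_iff.mp hU
    exact ⟨ε, hε, fun D hD => hUV (hεU (by rwa [Metric.mem_ball, dist_eq_norm]))⟩
  choose ε hε hεV using hball
  have := hI.to_subtype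
  obtain ⟨δ, hδ, hδε⟩ : ∃ δ > 0, ∀ a : I, δ ≤ ε a := by
    rcases isEmpty_or_nonempty I with h | h
    · exact ⟨1, one_pos, fun a => isEmptyElim a⟩
    · obtain ⟨a, ha⟩ := Finite.exists_min ε
      exact ⟨ε a, hε a, ha⟩
  obtain ⟨F, _, _, _, ψ, φ, hfin, hψ, hφ, hoz, happ⟩ := hA hI.toFinset δ hδ
  let D : DecomposableApproximation A :=
    { F := F, cstar := inferInstance, order := inferInstance, starOrdered := inferInstance,
      finite := hfin, ψ := ψ, φ := φ, contractive_ψ := hψ, contractive_φ := hφ, orderZero := hoz }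
  have hD : D ∈ ⋂ a : I, V a := Set.mem_iInter.mpr fun a => hεV a D <| by
    have := happ a (hI.mem_toFinset.mpr a.2)
    rw [Fin.sum_univ_two] at this
    exact this.trans_le (hδε a)
  rw [← hempty] at hD
  exact hD

/-- The Cauchy–Schwarz inequality for the vectors `b ⊗ 1 - e ⊗ b` and `c ⊗ 1`. The length of the
first vector for `T 0` is bounded by its length for `T 0 + T 1`. -/
lemma norm_T_mul_sub_sq_le (D : DecomposableApproximation A) (i : Fin 2) {e : A}
    (he : star e = e) (b c : A) :
    ‖D.T i (star b * c) - star b * D.T i (e * c)‖ ^ 2 ≤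
      ‖(D.T 0 (star b * b) + D.T 1 (star b * b)) - (D.T 0 (star b * e) + D.T 1 (star b * e)) * b
        - star b * (D.T 0 (e * b) + D.T 1 (e * b))
        + star b * (D.T 0 (e * e) + D.T 1 (e * e)) * b‖ * ‖star c * c‖ := by
  let X : Fin 2 → A := fun j => D.T j (star b * b) - D.T j (star b * e) * b
    - star b * D.T j (e * b) + star b * D.T j (e * e) * b
  have hform : ∀ (j : Fin 2) (g g' : A), 0 ≤ star g * X j * g
      + star g * (D.T j (star b * c) - star b * D.T j (e * c)) * g'
      + star g' * star (D.T j (star b * c) - star b * D.T j (e * c)) * g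
      + star g' * D.T j (star c * c) * g' := by
    intro j g g'
    have h := (D.T j).three_nonneg b e c g (-(b * g)) g'
    convert h using 1
    simp only [X, star_sub, star_mul, star_neg, star_star, ← map_star, he]
    noncomm_ring
  have hX : ∀ (j : Fin 2) (g : A), 0 ≤ star g * X j * g := fun j g => by
    simpa using hform j g 0
  have hsum : (D.T 0 (star b * b) + D.T 1 (star b * b))
        - (D.T 0 (star b * e) + D.T 1 (star b * e)) * b
        - star b * (D.T 0 (e * b) + D.T 1 (e * b))
        + star b * (D.T 0 (e * e) + D.T 1 (e * e)) * b = X 0 + X 1 := by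
    simp only [X]; noncomm_ring
  rw [hsum]
  refine (CStarAlgebra.norm_sq_le_of_form_nonneg (P := X 0 + X 1) (Q := D.T i (star c * c))
    (by rw [isSelfAdjoint_iff, ← map_star, star_mul, star_star]) fun g g' => ?_).trans
    (mul_le_mul_of_nonneg_left (D.norm_T_le i _) (norm_nonneg _))
  have e1 : star g * (X 0 + X 1) * g = star g * X 0 * g + star g * X 1 * g := by noncomm_ring
  rw [e1]
  fin_cases i
  · convert add_nonneg (hform 0 g g') (hX 1 g) using 1
    simp only [Fin.zero_eta]
    abel
  · convert add_nonneg (hform 1 g g') (hX 0 g) using 1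
    simp only [Fin.mk_one]
    abel

lemma tendsto_sub_two_mul (b : A) :
    Tendsto (fun e => star b * b - star b * e * b - star b * (e * b) + star b * (e * e) * b)
      (CStarAlgebra.approximateUnit A) (𝓝 0) := by
  have hl := (CStarAlgebra.increasingApproximateUnit A).tendsto_mul_left (star b)
  have hr := (CStarAlgebra.increasingApproximateUnit A).tendsto_mul_right b
  have h := (((tendsto_const_nhds (x := star b * b)).sub (hl.mul_const b)).sub
    (hr.const_mul (star b))).add (hl.mul hr)
  simp only [sub_self, zero_sub, neg_add_cancel] at h
  exact h.congr fun e => by noncomm_ring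

/-- Asymptotically, `T i` is a left module map: the limit of `T i` is completely positive and
dominated by the identity, hence given by multiplication by an element of the commutant. -/
lemma eventually_T_mul_left (a c : A) {δ : ℝ} (hδ : 0 < δ) :
    ∀ᶠ D in convergence A, ∀ i, ‖D.T i (a * c) - a * D.T i c‖ < δ := by
  obtain ⟨b, rfl⟩ : ∃ b, a = star b := ⟨star a, (star_star a).symm⟩
  set κ : ℝ := (δ / 2) ^ 2 / (‖c‖ ^ 2 + 1) with hκ
  have hκ0 : 0 < κ := by positivity
  set l := CStarAlgebra.approximateUnit A
  have hl := CStarAlgebra.increasingApproximateUnit A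
  have h1 : ∀ᶠ e in l, ‖star b * b - star b * e * b - star b * (e * b)
      + star b * (e * e) * b‖ < κ := by
    have := (tendsto_sub_two_mul b).norm
    rw [norm_zero] at this
    exact this.eventually_lt_const hκ0
  have h2 : ∀ᶠ e in l, ‖star b‖ * ‖e * c - c‖ < δ / 2 := by
    have := ((hl.tendsto_mul_right c).sub_const c).norm.const_mul ‖star b‖
    rw [sub_self, norm_zero, mul_zero] at this
    exact this.eventually_lt_const (by positivity)
  obtain ⟨e, he1, he2, he0⟩ := (h1.and (h2.and hl.eventually_nonneg)).exists
  have hes : star e = e := he0.isSelfAdjoint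
  have hlim : ∀ᶠ D in convergence A, ‖(D.T 0 (star b * b) + D.T 1 (star b * b))
        - (D.T 0 (star b * e) + D.T 1 (star b * e)) * b
        - star b * (D.T 0 (e * b) + D.T 1 (e * b))
        + star b * (D.T 0 (e * e) + D.T 1 (e * e)) * b‖ < κ := by
    have := ((((tendsto_convergence (star b * b)).sub
      ((tendsto_convergence (star b * e)).mul_const b)).sub
      ((tendsto_convergence (e * b)).const_mul (star b))).add
      (((tendsto_convergence (e * e)).const_mul (star b)).mul_const b)).norm
    exact this.eventually_lt_const he1
  filter_upwards [hlim] with D hD i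
  have h3 : ‖D.T i (star b * c) - star b * D.T i (e * c)‖ ≤ δ / 2 := by
    refine le_of_sq_le_sq ((D.norm_T_mul_sub_sq_le i hes b c).trans ?_) (by positivity)
    rw [CStarRing.norm_star_mul_self, ← sq]
    calc _ ≤ κ * ‖c‖ ^ 2 := by gcongr
      _ ≤ κ * (‖c‖ ^ 2 + 1) := by gcongr; linarith
      _ = _ := div_mul_cancel₀ _ (by positivity)
  have h4 : ‖star b * D.T i (e * c) - star b * D.T i c‖ < δ / 2 := by
    rw [← mul_sub, ← map_sub]
    refine lt_of_le_of_lt ((norm_mul_le _ _).trans ?_) he2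
    gcongr
    exact D.norm_T_le i _
  calc _ ≤ _ := norm_sub_le_norm_sub_add_norm_sub _ (star b * D.T i (e * c)) _
    _ < δ := by linarith

lemma eventually_T_mul_right (a c : A) {δ : ℝ} (hδ : 0 < δ) :
    ∀ᶠ D in convergence A, ∀ i, ‖D.T i (a * c) - D.T i a * c‖ < δ := by
  filter_upwards [eventually_T_mul_left (star c) (star a) hδ] with D hD i
  have := hD i
  rw [← norm_star] at this
  simpa only [star_sub, star_mul, map_star, star_star, ← star_mul] using this

end DecomposableApproximation

end Approximations

/-! ### Elements of trace zero -/

section TraceZero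

open Filter Topology

variable {A : Type*} [NonUnitalCStarAlgebra A]

lemma TrEquiv.mem_closedCommutatorSpan {h : A} (hTr : TrEquiv h 0) :
    h ∈ closedCommutatorSpan A := by
  have := (Submodule.Quotient.mk_eq_zero (closedCommutatorSpan A)).mp hTr
  rwa [sub_zero] at this

lemma norm_commutator_le (x y : A) : ‖x * y - y * x‖ ≤ 2 * ‖x‖ * ‖y‖ := by
  calc _ ≤ ‖x‖ * ‖y‖ + ‖y‖ * ‖x‖ :=
        (norm_sub_le _ _).trans (add_le_add (norm_mul_le _ _) (norm_mul_le _ _))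
    _ = _ := by ring

variable [PartialOrder A] [StarOrderedRing A]

namespace DecomposableApproximation

lemma norm_T_mul_T_sub_le (D : DecomposableApproximation A) (i : Fin 2) {f a b : A} {r : ℝ}
    (hf : ‖f‖ ≤ 1) (h1 : ‖D.T i (a * b) - a * D.T i b‖ ≤ r)
    (h2 : ‖D.T i (f * a) - D.T i f * a‖ ≤ r) (h3 : ‖f * a - a‖ ≤ r) :
    ‖D.T i a * D.T i b - D.T i f * D.T i (a * b)‖ ≤ r * (1 + 2 * ‖b‖) := by
  have e : D.T i a * D.T i b - D.T i f * D.T i (a * b)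
      = -(D.T i (f * a - a) * D.T i b) + (D.T i (f * a) - D.T i f * a) * D.T i b
        - D.T i f * (D.T i (a * b) - a * D.T i b) := by
    rw [map_sub]; noncomm_ring
  have hr : 0 ≤ r := (norm_nonneg _).trans h1
  have hb := D.norm_T_le i b
  have n1 : ‖D.T i (f * a - a) * D.T i b‖ ≤ r * ‖b‖ :=
    (norm_mul_le _ _).trans (by gcongr; exact (D.norm_T_le i _).trans h3)
  have n2 : ‖(D.T i (f * a) - D.T i f * a) * D.T i b‖ ≤ r * ‖b‖ :=
    (norm_mul_le _ _).trans (by gcongr)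
  have n3 : ‖D.T i f * (D.T i (a * b) - a * D.T i b)‖ ≤ 1 * r :=
    (norm_mul_le _ _).trans (by gcongr; exact (D.norm_T_le i _).trans hf)
  rw [e]
  calc _ ≤ _ := (norm_sub_le _ _).trans (add_le_add (norm_add_le _ _) le_rfl)
    _ ≤ r * ‖b‖ + r * ‖b‖ + 1 * r := by rw [norm_neg]; gcongr
    _ = _ := by ring

lemma norm_T_commutator_le (D : DecomposableApproximation A) (i : Fin 2) {f a : A} {r : ℝ}
    (hf : ‖f‖ ≤ 1) (h1 : ‖D.T i (a * f) - a * D.T i f‖ ≤ r)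
    (h2 : ‖D.T i (f * a) - D.T i f * a‖ ≤ r) (h3 : ‖f * a - a‖ ≤ r) (h4 : ‖a * f - a‖ ≤ r) :
    ‖D.T i f * D.T i a - D.T i a * D.T i f‖ ≤ 4 * r := by
  have e : D.T i f * D.T i a - D.T i a * D.T i f
      = -(D.T i f * D.T i (a * f - a)) + D.T i f * (D.T i (a * f) - a * D.T i f)
        - (D.T i (f * a) - D.T i f * a) * D.T i f + D.T i (f * a - a) * D.T i f := by
    rw [map_sub, map_sub]; noncomm_ring
  have hr : 0 ≤ r := (norm_nonneg _).trans h1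
  have hTf : ‖D.T i f‖ ≤ 1 := (D.norm_T_le i f).trans hf
  have n1 : ‖D.T i f * D.T i (a * f - a)‖ ≤ 1 * r :=
    (norm_mul_le _ _).trans (by gcongr; exact (D.norm_T_le i _).trans h4)
  have n2 : ‖D.T i f * (D.T i (a * f) - a * D.T i f)‖ ≤ 1 * r :=
    (norm_mul_le _ _).trans (by gcongr)
  have n3 : ‖(D.T i (f * a) - D.T i f * a) * D.T i f‖ ≤ r * 1 :=
    (norm_mul_le _ _).trans (by gcongr)
  have n4 : ‖D.T i (f * a - a) * D.T i f‖ ≤ r * 1 :=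
    (norm_mul_le _ _).trans (by gcongr; exact (D.norm_T_le i _).trans h3)
  rw [e]
  calc _ ≤ _ := (norm_add_le _ _).trans (add_le_add ((norm_sub_le _ _).trans
          (add_le_add (norm_add_le _ _) le_rfl)) le_rfl)
    _ ≤ 1 * r + 1 * r + r * 1 + r * 1 := by rw [norm_neg]; gcongr
    _ = _ := by ring

variable (A) in
/-- The elements whose images in the summands `F i` have asymptotically vanishing normalized traces
on all blocks on which `φ i` is bounded below. -/
noncomputable def asymptoticallyTraceless : Submodule ℂ A where
  carrier := {y | ∀ η > 0, ∀ ε > 0, ∀ᶠ D in convergence A, ∀ (i : Fin 2) (C : Finset (D.F i)),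
    IsBlock C → (∀ p ∈ C, η ≤ ‖D.φ i p‖) → ‖blockTrace C (D.ψ i y)‖ ≤ C.card * ε}
  zero_mem' := fun η _ ε hε => Eventually.of_forall fun D i C hC _ => by
    rw [map_zero, hC.blockTrace_zero, norm_zero]; positivity
  add_mem' := fun {x y} hx hy η hη ε hε => by
    filter_upwards [hx η hη (ε / 2) (by positivity), hy η hη (ε / 2) (by positivity)]
      with D h1 h2 i C hC hg
    rw [map_add, hC.blockTrace_add]
    calc _ ≤ _ := norm_add_le _ _
      _ ≤ C.card * (ε / 2) + C.card * (ε / 2) := add_le_add (h1 i C hC hg) (h2 i C hC hg)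
      _ = _ := by ring
  smul_mem' := fun t y hy η hη ε hε => by
    filter_upwards [hy η hη (ε / (‖t‖ + 1)) (by positivity)] with D h1 i C hC hg
    rw [map_smul, hC.blockTrace_smul, norm_mul]
    have h2 := h1 i C hC hg
    calc _ ≤ (‖t‖ + 1) * (C.card * (ε / (‖t‖ + 1))) := by gcongr; linarith
      _ = _ := by field_simp

lemma isClosed_asymptoticallyTraceless :
    IsClosed (asymptoticallyTraceless A : Set A) := by
  refine isClosed_of_closure_subset fun y hy η hη ε hε => ?_
  obtain ⟨z, hz, hyz⟩ := Metric.mem_closure_iff.mp hy (ε / 2) (by positivity)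
  filter_upwards [hz η hη (ε / 2) (by positivity)] with D h1 i C hC hg
  have e : D.ψ i y = D.ψ i z + D.ψ i (y - z) := by rw [← map_add]; congr 1; abel
  have h2 : ‖blockTrace C (D.ψ i (y - z))‖ ≤ C.card * (ε / 2) := by
    refine (hC.norm_blockTrace_le_norm _).trans ?_
    gcongr
    refine (D.contractive_ψ i _).trans ?_
    rw [← dist_eq_norm]; exact hyz.le
  rw [e, hC.blockTrace_add]
  calc _ ≤ _ := norm_add_le _ _
    _ ≤ C.card * (ε / 2) + C.card * (ε / 2) := add_le_add (h1 i C hC hg) h2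
    _ = _ := by ring

lemma exists_approximate_unit_square (a b c : A) {r : ℝ} (hr : 0 < r) :
    ∃ e : A, star e = e ∧ ‖e‖ ≤ 1 ∧ ‖e * e * a - a‖ ≤ r ∧ ‖e * e * b - b‖ ≤ r ∧
      ‖a * (e * e) - a‖ ≤ r ∧ ‖c - e * (e * c)‖ ≤ r := by
  have hl := CStarAlgebra.increasingApproximateUnit A
  have hleft : ∀ x : A, ∀ᶠ e in CStarAlgebra.approximateUnit A, ‖e * x - x‖ < r / 2 := fun x => by
    have := ((hl.tendsto_mul_right x).sub_const x).norm
    rw [sub_self, norm_zero] at this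
    exact this.eventually_lt_const (by positivity)
  have hright : ∀ᶠ e in CStarAlgebra.approximateUnit A, ‖a * e - a‖ < r / 2 := by
    have := ((hl.tendsto_mul_left a).sub_const a).norm
    rw [sub_self, norm_zero] at this
    exact this.eventually_lt_const (by positivity)
  obtain ⟨e, ha, hb, hc, ha', h0, h1⟩ := ((hleft a).and ((hleft b).and ((hleft c).and
    (hright.and (hl.eventually_nonneg.and hl.eventually_norm))))).exists
  have key : ∀ x : A, ‖e * x - x‖ < r / 2 → ‖e * (e * x) - x‖ ≤ r := fun x hx => by
    have e1 : e * (e * x) - x = e * (e * x - x) + (e * x - x) := by noncomm_ring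
    rw [e1]
    calc _ ≤ ‖e‖ * ‖e * x - x‖ + ‖e * x - x‖ :=
          (norm_add_le _ _).trans (add_le_add (norm_mul_le _ _) le_rfl)
      _ ≤ 1 * (r / 2) + r / 2 := by gcongr
      _ = r := by ring
  refine ⟨e, h0.isSelfAdjoint, h1, by rw [mul_assoc]; exact key a ha,
    by rw [mul_assoc]; exact key b hb, ?_, by rw [norm_sub_rev]; exact key c hc⟩
  have e1 : a * (e * e) - a = (a * e - a) * e + (a * e - a) := by noncomm_ring
  rw [e1]
  calc _ ≤ ‖a * e - a‖ * ‖e‖ + ‖a * e - a‖ :=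
        (norm_add_le _ _).trans (add_le_add (norm_mul_le _ _) le_rfl)
    _ ≤ r / 2 * 1 + r / 2 := by gcongr
    _ = r := by ring

lemma commutator_mem_asymptoticallyTraceless (a b : A) :
    a * b - b * a ∈ asymptoticallyTraceless A := by
  intro η hη ε hε
  set y := a * b - b * a with hy
  -- `n` is chosen for the term `(1 - d)ⁿ ψ(y)`, then `δ` for the `n` remaining terms.
  obtain ⟨n, hn0, hn⟩ : ∃ n : ℕ, 0 < n ∧ √(1 / n * ‖y‖ ^ 2) ≤ ε / 2 := by
    obtain ⟨n, hn⟩ := exists_nat_gt (‖y‖ ^ 2 / (ε / 2) ^ 2)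
    have hn0 : (0 : ℝ) < n := lt_of_le_of_lt (by positivity) hn
    refine ⟨n, by exact_mod_cast hn0, Real.sqrt_le_iff.mpr ⟨by positivity, ?_⟩⟩
    rw [div_lt_iff₀ (by positivity)] at hn
    rw [one_div, inv_mul_le_iff₀ hn0]
    exact hn.le
  set K : ℝ := 1 + n * (1 / η ^ 2 * (2 + n * ‖b‖)) with hK
  have hK0 : 0 < K := by positivity
  set δ : ℝ := ε / 2 / K with hδ
  have hδ0 : 0 < δ := by positivity
  set r : ℝ := δ / (4 + 2 * ‖a‖ + 2 * ‖b‖) with hr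
  have hr0 : 0 < r := by positivity
  have hrδ : r * (4 + 2 * ‖a‖ + 2 * ‖b‖) = δ := div_mul_cancel₀ _ (by positivity)
  have hra : 0 ≤ r * ‖a‖ := by positivity
  have hrb : 0 ≤ r * ‖b‖ := by positivity
  obtain ⟨e, he, he1, h1, h2, h3, h4⟩ := exists_approximate_unit_square a b y hr0
  have hee : ‖e * e‖ ≤ 1 := (norm_mul_le _ _).trans (mul_le_one₀ he1 (norm_nonneg _) he1)
  filter_upwards [eventually_T_mul_left a b hr0, eventually_T_mul_left b a hr0,
    eventually_T_mul_left a (e * e) hr0, eventually_T_mul_right (e * e) a hr0,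
    eventually_T_mul_right (e * e) b hr0] with D t1 t2 t3 t4 t5 i C hC hg
  have s1 := D.norm_T_mul_T_sub_le i hee (t1 i).le (t4 i).le h1
  have s2 := D.norm_T_mul_T_sub_le i hee (t2 i).le (t5 i).le h2
  have s3 := D.norm_T_commutator_le i hee (t3 i).le (t4 i).le h1 h3
  have main := norm_blockTrace_commutator_le (D.contractive_ψ i) (D.orderZero i) he he1 hη
    (s1.trans (by linarith)) (s2.trans (by linarith)) (s3.trans (by linarith))
    (h4.trans (by linarith : r ≤ δ)) hn0 hC hg
  refine main.trans (mul_le_mul_of_nonneg_left ?_ (Nat.cast_nonneg _))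
  have e1 : δ + n * (δ / η ^ 2 * (2 + n * ‖b‖)) = ε / 2 := by
    calc _ = δ * K := by rw [hK]; ring
      _ = _ := div_mul_cancel₀ _ hK0.ne'
  linarith

lemma closedCommutatorSpan_le : closedCommutatorSpan A ≤ asymptoticallyTraceless A := by
  refine Submodule.topologicalClosure_minimal _ (Submodule.span_le.mpr ?_)
    isClosed_asymptoticallyTraceless
  rintro _ ⟨a, b, rfl⟩
  exact commutator_mem_asymptoticallyTraceless a b

end DecomposableApproximation

end TraceZero

theorem mainTheorem10 {A : Type*} [NonUnitalCStarAlgebra A] [PartialOrder A] [StarOrderedRing A]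
    (hA : NuclearDimensionAtMost A 1)
    (h : A) (hsa : IsSelfAdjoint h) (hTr : TrEquiv h 0)
    (ε : ℝ) (hε : 0 < ε) :
    ∃ h₁ h₂ h₃ h₄ : A,
      (IsSelfAdjoint h₁ ∧ IsSelfAdjoint h₂ ∧ IsSelfAdjoint h₃ ∧ IsSelfAdjoint h₄) ∧
      ‖(h₁ + h₂ + h₃ + h₄) - h‖ < ε ∧
      (‖h₁ * h₂ - h₂ * h₁‖ < ε ∧
        ‖h₃ * h₄ - h₄ * h₃‖ < ε ∧
        ‖(h₁ + h₂) * (h₃ + h₄) - (h₃ + h₄) * (h₁ + h₂)‖ < ε) ∧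
      (∀ k ∈ ({h₁, h₂, h₃, h₄} : Set A),
        ∃ x : A, k = star x * x - x * star x ∧ x * x = 0 ∧ ‖x‖ ^ 2 ≤ ‖h‖) := by
  open DecomposableApproximation in
  set M := ‖h‖ with hM
  have hM0 : 0 ≤ M := norm_nonneg h
  set r : ℝ := min 1 (ε / (6 * M + 5)) with hr
  have hr0 : 0 < r := lt_min one_pos (by positivity)
  have hr1 : r ≤ 1 := min_le_left _ _
  have hrε : r * (6 * M + 5) ≤ ε := by
    rw [← le_div_iff₀ (by positivity)]; exact min_le_right _ _
  have hrM : 0 ≤ r * M := by positivity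
  have htr := closedCommutatorSpan_le hTr.mem_closedCommutatorSpan
  have := convergence_neBot hA
  have hlim : ∀ᶠ D in convergence A, ‖D.T 0 h + D.T 1 h - h‖ < r := by
    have := ((tendsto_convergence h).sub_const h).norm
    rw [sub_self, norm_zero] at this
    exact this.eventually_lt_const hr0
  obtain ⟨D, hD, hDl, hDr, hDtr⟩ := (hlim.and ((eventually_T_mul_left h h hr0).and
    ((eventually_T_mul_right h h hr0).and
      (htr (r / (2 * (M + 1))) (by positivity) (r / 6) (by positivity))))).exists
  have hsummand : ∀ i, ∃ X Y : A, X * X = 0 ∧ Y * Y = 0 ∧ ‖X‖ ^ 2 ≤ M ∧ ‖Y‖ ^ 2 ≤ M ∧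
      Commute (star X * X - X * star X) (star Y * Y - Y * star Y) ∧
      ‖star X * X - X * star X + (star Y * Y - Y * star Y) - D.T i h‖ ≤ r := by
    intro i
    obtain ⟨X, Y, h1, h2, h3, h4, h5, h6⟩ := (D.orderZero i).exists_commutators
      (D.contractive_φ i) (k := D.ψ i h)
      (by rw [isSelfAdjoint_iff, ← map_star, hsa.star_eq]) (D.contractive_ψ i h)
      (show 0 < r / 6 by positivity) (show 0 < r / (2 * (M + 1)) by positivity) (hDtr i)
    refine ⟨X, Y, h1, h2, h3, h4, h5, h6.trans ?_⟩
    have : M * (r / (2 * (M + 1))) ≤ r / 2 := by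
      rw [mul_div_assoc', div_le_div_iff₀ (by positivity) two_pos]
      nlinarith
    linarith
  obtain ⟨X₁, X₂, hX₁, hX₂, hX₁n, hX₂n, hXc, hXT⟩ := hsummand 0
  obtain ⟨Y₁, Y₂, hY₁, hY₂, hY₁n, hY₂n, hYc, hYT⟩ := hsummand 1
  have hsc : ∀ x : A, IsSelfAdjoint (star x * x - x * star x) := fun x =>
    (IsSelfAdjoint.star_mul_self x).sub (IsSelfAdjoint.mul_star_self x)
  refine ⟨_, _, _, _, ⟨hsc X₁, hsc X₂, hsc Y₁, hsc Y₂⟩, ?_, ⟨?_, ?_, ?_⟩, ?_⟩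
  · set u := star X₁ * X₁ - X₁ * star X₁ + (star X₂ * X₂ - X₂ * star X₂)
    have e : u + (star Y₁ * Y₁ - Y₁ * star Y₁) + (star Y₂ * Y₂ - Y₂ * star Y₂) - h
        = (u - D.T 0 h) + ((star Y₁ * Y₁ - Y₁ * star Y₁) + (star Y₂ * Y₂ - Y₂ * star Y₂)
          - D.T 1 h) + (D.T 0 h + D.T 1 h - h) := by abel
    rw [e]
    calc _ ≤ _ := norm_add₃_le
      _ < r + r + r := add_lt_add_of_le_of_lt (add_le_add hXT hYT) hD
      _ ≤ ε := by linarith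
  · rw [hXc.eq, sub_self, norm_zero]; exact hε
  · rw [hYc.eq, sub_self, norm_zero]; exact hε
  · set u := star X₁ * X₁ - X₁ * star X₁ + (star X₂ * X₂ - X₂ * star X₂)
    set v := star Y₁ * Y₁ - Y₁ * star Y₁ + (star Y₂ * Y₂ - Y₂ * star Y₂)
    -- Since `T 0 h + T 1 h ≈ h`, this reduces to the commutator of `T 0 h` and `h`.
    have e : u * v - v * u = ((u - D.T 0 h) * v - v * (u - D.T 0 h))
        + (D.T 0 h * (v - D.T 1 h) - (v - D.T 1 h) * D.T 0 h)
        + (D.T 0 h * (D.T 0 h + D.T 1 h - h) - (D.T 0 h + D.T 1 h - h) * D.T 0 h)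
        + ((D.T 0 (h * h) - h * D.T 0 h) - (D.T 0 (h * h) - D.T 0 h * h)) := by noncomm_ring
    have hT0 : ‖D.T 0 h‖ ≤ M := D.norm_T_le 0 h
    have hv : ‖v‖ ≤ M + 1 := by
      have h1 : v = (v - D.T 1 h) + D.T 1 h := by abel
      rw [h1]
      calc _ ≤ _ := norm_add_le _ _
        _ ≤ r + M := add_le_add hYT (D.norm_T_le 1 h)
        _ ≤ _ := by linarith
    have n1 : ‖(u - D.T 0 h) * v - v * (u - D.T 0 h)‖ ≤ 2 * r * (M + 1) :=
      (norm_commutator_le _ _).trans (by gcongr)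
    have n2 : ‖D.T 0 h * (v - D.T 1 h) - (v - D.T 1 h) * D.T 0 h‖ ≤ 2 * M * r :=
      (norm_commutator_le _ _).trans (by gcongr)
    have n3 : ‖D.T 0 h * (D.T 0 h + D.T 1 h - h) - (D.T 0 h + D.T 1 h - h) * D.T 0 h‖
        ≤ 2 * M * r := (norm_commutator_le _ _).trans (by gcongr)
    have n4 : ‖(D.T 0 (h * h) - h * D.T 0 h) - (D.T 0 (h * h) - D.T 0 h * h)‖ < r + r :=
      (norm_sub_le _ _).trans_lt (add_lt_add (hDl 0) (hDr 0))
    rw [e]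
    calc _ ≤ _ := norm_add₄_le
      _ < 2 * r * (M + 1) + 2 * M * r + 2 * M * r + (r + r) := by linarith
      _ = r * (6 * M + 4) := by ring
      _ ≤ ε := by linarith
  · rintro k (rfl | rfl | rfl | rfl)
    exacts [⟨X₁, rfl, hX₁, hX₁n⟩, ⟨X₂, rfl, hX₂, hX₂n⟩, ⟨Y₁, rfl, hY₁, hY₁n⟩, ⟨Y₂, rfl, hY₂, hY₂n⟩]
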